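/- Let $M=\mathbb S^1\times[-\rho,\rho]$, $\rho>0$, and let $g_0=dr^2+f(r)^2\,d\theta^2$ ($r\in[-\rho,\rho]$, $f>0$ of class $C^2$) be a rotationally symmetric metric on $M$. Its geodesic curvature $k_{g_0}$ (with respect to the outward normal) is constant on each component of $\partial M$; let $k_1,k_2$ be the two constants, and assume $k_1,k_2\le 0$ and that at least one of them is negative. An unnormalised Ricci flow from $g_0$ is a family of metrics $\tilde g(\tilde t)$, $\tilde t\in[0,\tilde T)$, $0\le\tilde T\le\infty$, on $M$ (no symmetry required), continuous together with its space derivatives up to order two on $M\times[0,\tilde T)$, with $$\frac{\partial\tilde g}{\partial\tilde t}=-\tilde R\,\tilde g\ \text{ on } M\times(0,\tilde T),\qquad k_{\tilde g}=k_{g_0}\ \text{ on }\partial M\times(0,\tilde T),\qquad \tilde g(0)=g_0,$$ where $\tilde R$ is the scalar curvature. With $\phi(\tilde t)=1/A_{\tilde g(\tilde t)}(M)$, the associated normalised flow $g(t)$, $t\in[0,T)$, is defined by $g(t(\tilde t))=\phi(\tilde t)\,\tilde g(\tilde t)$, $t(\tilde t)=\int_0^{\tilde t}\phi(\tau)\,d\tau$,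 so that $A_{g(t)}(M)=1$ for all $t$. Let $R_{\min}(t)$ and $R_{\max}(t)$ be the minimum and the maximum over $M$ of the scalar curvature of $g(t)$. Then there is a constant $c_2>0$, depending only on $g_0$, such that for every normalised flow $g(t)$, $t\in[0,T)$, $T\le\infty$, from $g_0$ for which $R_{\min}(t)$ is attained on both components of $\partial M$ for every $t\in[0,T)$, one has $$R_{\max}(t)\ \ge\ \frac{2}{t+c_2}\qquad\text{for all } t\in[0,T).$$ In particular, if $T=\infty$, the convergence of the curvature to zero cannot be exponential: there are no $C\in\mathbb R$ and $\delta>0$ with $R_{\max}(t)\le Ce^{-\delta t}$ for all sufficiently large $t$. -/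

import Mathlib

namespace RicciCylinder

/-- The universal cover `ℝ × [-ρ, ρ]` of the cylinder `M = S¹ × [-ρ, ρ]`, with coordinates
`(θ, s)`; a tensor on `M` is a tensor on the strip that is `2π`-periodic in `θ`. -/
def strip (ρ : ℝ) : Set (ℝ × ℝ) := Set.univ ×ˢ Set.Icc (-ρ) ρ

/-- Matrix of a symmetric `2`-tensor in the coordinates `(θ, s)`: index `0` is `θ`, index `1`
is `s`.  Only the values on the strip matter. -/
abbrev Tensor2 : Type := ℝ × ℝ → Matrix (Fin 2) (Fin 2) ℝ

/-- The coordinate vectors `∂_θ` and `∂_s`. -/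
def coordVec (i : Fin 2) : ℝ × ℝ := if i = 0 then (1, 0) else (0, 1)

/-- Partial derivative in the coordinate direction `i`, one-sided in `s` on the boundary. -/
noncomputable def pd (ρ : ℝ) (i : Fin 2) (u : ℝ × ℝ → ℝ) (p : ℝ × ℝ) : ℝ :=
  fderivWithin ℝ u (strip ρ) p (coordVec i)

/-- A Riemannian metric of class `C²`, up to the boundary, on the cylinder. -/
structure IsMetric (ρ : ℝ) (g : Tensor2) : Prop where
  contDiffOn : ∀ i j, ContDiffOn ℝ 2 (fun p => g p i j) (strip ρ)
  periodic : ∀ p ∈ strip ρ, g (p.1 + 2 * Real.pi, p.2) = g p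
  posDef : ∀ p ∈ strip ρ, (g p).PosDef

/-- Christoffel symbols `Γ^k_{ij}` of the Levi-Civita connection. -/
noncomputable def christoffel (ρ : ℝ) (g : Tensor2) (k i j : Fin 2) (p : ℝ × ℝ) : ℝ :=
  (1 / 2) * ∑ l, (g p)⁻¹ k l *
    (pd ρ i (fun q => g q j l) p + pd ρ j (fun q => g q i l) p - pd ρ l (fun q => g q i j) p)

/-- Ricci tensor `R_{ij} = ∂_k Γ^k_{ij} - ∂_j Γ^k_{ik} + Γ^k_{kl} Γ^l_{ij} - Γ^k_{jl} Γ^l_{ik}`. -/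
noncomputable def ricci (ρ : ℝ) (g : Tensor2) (i j : Fin 2) (p : ℝ × ℝ) : ℝ :=
  ∑ k, (pd ρ k (christoffel ρ g k i j) p - pd ρ j (christoffel ρ g k i k) p
    + ∑ l, (christoffel ρ g k k l p * christoffel ρ g l i j p
      - christoffel ρ g k j l p * christoffel ρ g l i k p))

/-- Scalar curvature `R = g^{ij} R_{ij}` (twice the Gauss curvature). -/
noncomputable def scalarCurv (ρ : ℝ) (g : Tensor2) (p : ℝ × ℝ) : ℝ :=
  ∑ i, ∑ j, (g p)⁻¹ i j * ricci ρ g i j p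

/-- Geodesic curvature `k_g = -g(∇_T T, η)` of the boundary circle `s = ε ρ` (`ε = 1` or
`ε = -1`) at `(θ, ε ρ)`.  Here `T = ∂_θ / √g_{θθ}` is the unit tangent and `η` the outward unit
normal, for which `g(X, η) = ε X^s / √g^{ss}`; moreover `∇_T T` is `Γ^k_{θθ} ∂_k / g_{θθ}` up to
a multiple of `T`. -/
noncomputable def geodCurv (ρ : ℝ) (g : Tensor2) (ε θ : ℝ) : ℝ :=
  -(ε * (christoffel ρ g 1 0 0 (θ, ε * ρ) / g (θ, ε * ρ) 0 0)
    / Real.sqrt ((g (θ, ε * ρ))⁻¹ 1 1))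

/-- Total area of the cylinder. -/
noncomputable def area (ρ : ℝ) (g : Tensor2) : ℝ :=
  ∫ s in (-ρ)..ρ, ∫ θ in (0 : ℝ)..(2 * Real.pi), Real.sqrt (g (θ, s)).det

/-- Maximum of the scalar curvature over the cylinder. -/
noncomputable def Rmax (ρ : ℝ) (g : Tensor2) : ℝ := sSup (scalarCurv ρ g '' strip ρ)

/-- Minimum of the scalar curvature over the cylinder. -/
noncomputable def Rmin (ρ : ℝ) (g : Tensor2) : ℝ := sInf (scalarCurv ρ g '' strip ρ)

/-- The time interval `[0, T)`, where `T = ⊤` is allowed. -/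
def timeInterval (T : EReal) : Set ℝ := {t | 0 ≤ t ∧ (t : EReal) < T}

/-- The rotationally symmetric metric `dr² + f(r)² dθ²`, `r ∈ [-ρ, ρ]`. -/
def warped (f : ℝ → ℝ) : Tensor2 := fun p => !![f p.2 ^ 2, 0; 0, 1]

/-- Classical solution on `[0, T)` of the (unnormalised) Ricci flow `∂g/∂t = -R g` in `M`, with
`k_g = k_{g₀}` on `∂M` and `g = g₀` at time `0`.  The metric and its space derivatives up to order
two are continuous in space and time, up to the boundary and up to time `0`. No symmetry is
required. -/
structure IsRicciFlow (ρ : ℝ) (g₀ : Tensor2) (g : ℝ → Tensor2) (T : EReal) : Prop where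
  isMetric : ∀ t ∈ timeInterval T, IsMetric ρ (g t)
  continuousOn : ∀ i j, ContinuousOn (fun z : ℝ × (ℝ × ℝ) => g z.1 z.2 i j)
    (timeInterval T ×ˢ strip ρ)
  continuousOn_pd : ∀ i j a, ContinuousOn
    (fun z : ℝ × (ℝ × ℝ) => pd ρ a (fun q => g z.1 q i j) z.2) (timeInterval T ×ˢ strip ρ)
  continuousOn_pd_pd : ∀ i j a b, ContinuousOn
    (fun z : ℝ × (ℝ × ℝ) => pd ρ a (pd ρ b (fun q => g z.1 q i j)) z.2)
    (timeInterval T ×ˢ strip ρ)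
  evolution : ∀ t ∈ timeInterval T, 0 < t → ∀ p ∈ strip ρ, ∀ i j,
    HasDerivAt (fun τ => g τ p i j) (-(scalarCurv ρ (g t) p) * g t p i j) t
  boundary : ∀ t ∈ timeInterval T, 0 < t → ∀ θ : ℝ,
    geodCurv ρ (g t) 1 θ = geodCurv ρ g₀ 1 θ ∧ geodCurv ρ (g t) (-1) θ = geodCurv ρ g₀ (-1) θ
  initial : ∀ p ∈ strip ρ, g 0 p = g₀ p

/-- The rescaled time `t(τ) = ∫₀^τ φ`, where `φ = 1 / area`. -/
noncomputable def normTime (ρ : ℝ) (h : ℝ → Tensor2) (τ : ℝ) : ℝ :=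
  ∫ x in (0 : ℝ)..τ, (area ρ (h x))⁻¹

/-- `g` is, on `[0, T)`, the normalised Ricci flow with initial data `g₀`: it arises from a
solution `h` of the unnormalised flow on some `[0, S)` by scaling with `φ = 1 / area`, so that the
area becomes `1`, and by passing to the time `t = ∫ φ`. -/
def IsNormalisedRicciFlow (ρ : ℝ) (g₀ : Tensor2) (g : ℝ → Tensor2) (T : EReal) : Prop :=
  ∃ (h : ℝ → Tensor2) (S : EReal), IsRicciFlow ρ g₀ h S ∧
    normTime ρ h '' timeInterval S = timeInterval T ∧
    ∀ τ ∈ timeInterval S, ∀ p ∈ strip ρ, g (normTime ρ h τ) p = (area ρ (h τ))⁻¹ • h τ p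

end RicciCylinder

namespace RicciCylinder

open Set Filter Topology Pointwise

/-! ### Partial derivatives on the closed strip, one-sided at the boundary -/

section Calculus

variable {ρ : ℝ} {u v : ℝ × ℝ → ℝ} {p : ℝ × ℝ}

/-! The argument is Gauss–Bonnet combined with the evolution of the boundary lengths. Let `h` be the
unnormalised flow, `A` its area, `P` its total scalar curvature. All entries of `h` solve the same
linear equation `y' = -R y`, so `h = e ^ w g₀` (`ratio_eq`, `eqOn_conformal`).

The flow stays rotationally symmetric: a parabolic maximum principle compares `w` with its rotations
(`logFactor_le_rotate`). At a boundary maximum of the difference, `k₁, k₂ ≤ 0` gives the outward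
derivative the sign that rules out an obstruction.

The cylinder has Euler characteristic zero, so `P` is `-2` times the boundary integral of the
geodesic curvature, a combination of the two boundary lengths with weights `-2 k₁, -2 k₂ ≥ 0`, not
both zero (`totalCurv`). A boundary length `L` satisfies `L' = -(R / 2) L`. Since `R` equals its
minimum on both components, `P' = -(Rmin / 2) P`. With `Rmin * A ≤ P` this gives `(1 / P)' = Rmin /
(2 P) ≤ 1 / (2 A)`, half the speed of the normalised time `t`. Hence `1 / P ≤ 1 / P(0) + t / 2`,
that is, `P ≥ 2 / (t + 2 / P(0))`.

After normalisation the maximal curvature is `A * Rmax(h) ≥ P`. Since `P(0)` depends on `g₀` only,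
`c₂ = 2 / P(0)` works, and a bound of order `1 / t` excludes exponential decay. -/

theorem mem_strip : p ∈ strip ρ ↔ p.2 ∈ Icc (-ρ) ρ := by
  simp [strip]

theorem uniqueDiffOn_strip (hρ : 0 < ρ) : UniqueDiffOn ℝ (strip ρ) :=
  uniqueDiffOn_univ.prod (uniqueDiffOn_Icc (by linarith))

theorem pd_congr (i : Fin 2) (h : EqOn u v (strip ρ)) (hp : p ∈ strip ρ) :
    pd ρ i u p = pd ρ i v p := by
  rw [pd, pd, fderivWithin_congr h (h hp)]

theorem contDiffOn_pd (hρ : 0 < ρ) (i : Fin 2) {m n : WithTop ℕ∞} (h : ContDiffOn ℝ n u (strip ρ))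
    (hmn : m + 1 ≤ n) : ContDiffOn ℝ m (pd ρ i u) (strip ρ) :=
  (h.fderivWithin (uniqueDiffOn_strip hρ) hmn).clm_apply contDiffOn_const

theorem pd_of_hasFDerivWithinAt (hρ : 0 < ρ) (hp : p ∈ strip ρ) (i : Fin 2) {L : ℝ × ℝ →L[ℝ] ℝ}
    (h : HasFDerivWithinAt u L (strip ρ) p) : pd ρ i u p = L (coordVec i) := by
  rw [pd, h.fderivWithin (uniqueDiffOn_strip hρ p hp)]

theorem pd_const (i : Fin 2) (c : ℝ) : pd ρ i (fun _ => c) p = 0 := by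
  simp [pd]

theorem pd_add (hρ : 0 < ρ) (hp : p ∈ strip ρ) (i : Fin 2)
    (hu : DifferentiableWithinAt ℝ u (strip ρ) p) (hv : DifferentiableWithinAt ℝ v (strip ρ) p) :
    pd ρ i (fun q => u q + v q) p = pd ρ i u p + pd ρ i v p := by
  exact (pd_of_hasFDerivWithinAt hρ hp i (hu.hasFDerivWithinAt.add hv.hasFDerivWithinAt)).trans (by simp [pd])

theorem pd_sub (hρ : 0 < ρ) (hp : p ∈ strip ρ) (i : Fin 2)
    (hu : DifferentiableWithinAt ℝ u (strip ρ) p) (hv : DifferentiableWithinAt ℝ v (strip ρ) p) :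
    pd ρ i (fun q => u q - v q) p = pd ρ i u p - pd ρ i v p := by
  exact (pd_of_hasFDerivWithinAt hρ hp i (hu.hasFDerivWithinAt.sub hv.hasFDerivWithinAt)).trans (by simp [pd])

theorem pd_mul (hρ : 0 < ρ) (hp : p ∈ strip ρ) (i : Fin 2)
    (hu : DifferentiableWithinAt ℝ u (strip ρ) p) (hv : DifferentiableWithinAt ℝ v (strip ρ) p) :
    pd ρ i (fun q => u q * v q) p = u p * pd ρ i v p + v p * pd ρ i u p := by
  exact (pd_of_hasFDerivWithinAt hρ hp i (hu.hasFDerivWithinAt.mul hv.hasFDerivWithinAt)).trans (by simp [pd])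

theorem pd_const_mul (hρ : 0 < ρ) (hp : p ∈ strip ρ) (i : Fin 2) (c : ℝ)
    (hu : DifferentiableWithinAt ℝ u (strip ρ) p) :
    pd ρ i (fun q => c * u q) p = c * pd ρ i u p := by
  rw [pd_of_hasFDerivWithinAt hρ hp i (hu.hasFDerivWithinAt.const_mul c)]
  simp [pd]

theorem pd_exp (hρ : 0 < ρ) (hp : p ∈ strip ρ) (i : Fin 2)
    (hu : DifferentiableWithinAt ℝ u (strip ρ) p) :
    pd ρ i (fun q => Real.exp (u q)) p = Real.exp (u p) * pd ρ i u p := by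
  rw [pd_of_hasFDerivWithinAt hρ hp i hu.hasFDerivWithinAt.exp]
  simp [pd]

theorem pd_log (hρ : 0 < ρ) (hp : p ∈ strip ρ) (i : Fin 2)
    (hu : DifferentiableWithinAt ℝ u (strip ρ) p) (h0 : u p ≠ 0) :
    pd ρ i (fun q => Real.log (u q)) p = pd ρ i u p / u p := by
  rw [pd_of_hasFDerivWithinAt hρ hp i (hu.hasFDerivWithinAt.log h0)]
  simp [pd, div_eq_inv_mul]

theorem pd_div (hρ : 0 < ρ) (hp : p ∈ strip ρ) (i : Fin 2)
    (hu : DifferentiableWithinAt ℝ u (strip ρ) p) (hv : DifferentiableWithinAt ℝ v (strip ρ) p)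
    (h0 : v p ≠ 0) :
    pd ρ i (fun q => u q / v q) p = (pd ρ i u p * v p - u p * pd ρ i v p) / v p ^ 2 := by
  have hv' := (hasDerivAt_inv h0).comp_hasFDerivWithinAt p hv.hasFDerivWithinAt
  have := hu.hasFDerivWithinAt.mul hv'
  simp only [div_eq_mul_inv]
  refine (pd_of_hasFDerivWithinAt hρ hp i this).trans ?_
  simp only [pd, Function.comp_apply, add_apply, smul_apply,
    smul_eq_mul]
  field_simp
  ring

theorem hasDerivWithinAt_line (hu : DifferentiableWithinAt ℝ u (strip ρ) p) :
    HasDerivWithinAt (fun s => u (p.1, s)) (pd ρ 1 u p) (Icc (-ρ) ρ) p.2 := by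
  have hl : HasDerivWithinAt (fun s : ℝ => (p.1, s)) ((0 : ℝ), (1 : ℝ)) (Icc (-ρ) ρ) p.2 :=
    (hasDerivWithinAt_const _ _ _).prodMk (hasDerivWithinAt_id _ _)
  have := hu.hasFDerivWithinAt.comp_hasDerivWithinAt (f := fun s : ℝ => (p.1, s)) p.2 hl
    (fun s hs => mem_strip.2 hs)
  simpa [pd, coordVec, Function.comp_def] using this

theorem pd_comp_snd (hρ : 0 < ρ) (hp : p ∈ strip ρ) {f : ℝ → ℝ}
    (hf : DifferentiableWithinAt ℝ f (Icc (-ρ) ρ) p.2) :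
    pd ρ 0 (fun q => f q.2) p = 0 ∧ pd ρ 1 (fun q => f q.2) p = derivWithin f (Icc (-ρ) ρ) p.2 := by
  have h := hf.hasFDerivWithinAt.comp (f := fun q : ℝ × ℝ => q.2) p
    (hasFDerivAt_snd.hasFDerivWithinAt (s := strip ρ)) (fun q hq => mem_strip.1 hq)
  constructor
  · rw [show (fun q : ℝ × ℝ => f q.2) = f ∘ fun q => q.2 from rfl,
      pd_of_hasFDerivWithinAt hρ hp 0 h]
    simp [coordVec]
  · rw [show (fun q : ℝ × ℝ => f q.2) = f ∘ fun q => q.2 from rfl,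
      pd_of_hasFDerivWithinAt hρ hp 1 h]
    simp [coordVec, derivWithin]

theorem contDiffOn_comp_snd {f : ℝ → ℝ} {n : WithTop ℕ∞} (hf : ContDiffOn ℝ n f (Icc (-ρ) ρ)) :
    ContDiffOn ℝ n (fun q : ℝ × ℝ => f q.2) (strip ρ) :=
  hf.comp contDiffOn_snd fun _ hq => mem_strip.1 hq

/-- The strip is invariant under translations in `θ`, so the derivative within it commutes with
them. -/
theorem pd_rotate (i : Fin 2) (α : ℝ) :
    pd ρ i (fun q => u (q.1 + α, q.2)) p = pd ρ i u (p.1 + α, p.2) := by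
  have h := fderivWithin_comp_add_right (𝕜 := ℝ) (f := u) (s := strip ρ) (x := p) ((α, 0) : ℝ × ℝ)
  have hs : ((α, 0) : ℝ × ℝ) +ᵥ strip ρ = strip ρ := by
    ext q
    simp [mem_vadd_set_iff_neg_vadd_mem, strip]
  rw [hs] at h
  have e : ∀ q : ℝ × ℝ, q + (α, 0) = (q.1 + α, q.2) := fun q => by ext <;> simp
  simp only [e] at h
  rw [pd, pd, h]

end Calculus

/-! ### Curvatures of a metric conformal to the warped product -/

section Geometry

variable {ρ : ℝ}

/-- All derivatives are taken within the strip. This allows a flow, known only there, to be replaced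
by its conformal form. -/
theorem christoffel_congr {g g' : Tensor2} (h : EqOn g g' (strip ρ)) (k i j : Fin 2) :
    EqOn (christoffel ρ g k i j) (christoffel ρ g' k i j) (strip ρ) := by
  intro p hp
  have e : ∀ a i j, pd ρ a (fun q => g q i j) p = pd ρ a (fun q => g' q i j) p := fun a i j =>
    pd_congr a (fun q hq => by simp only [h hq]) hp
  simp only [christoffel, e, h hp]

theorem ricci_congr {g g' : Tensor2} (h : EqOn g g' (strip ρ)) (i j : Fin 2) :
    EqOn (ricci ρ g i j) (ricci ρ g' i j) (strip ρ) := by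
  intro p hp
  simp only [ricci, pd_congr _ (christoffel_congr h _ _ _) hp, christoffel_congr h _ _ _ hp]

theorem scalarCurv_congr {g g' : Tensor2} (h : EqOn g g' (strip ρ)) :
    EqOn (scalarCurv ρ g) (scalarCurv ρ g') (strip ρ) := by
  intro p hp
  simp only [scalarCurv, ricci_congr h _ _ hp, h hp]

theorem geodCurv_congr {g g' : Tensor2} (h : EqOn g g' (strip ρ)) {ε θ : ℝ}
    (hp : (θ, ε * ρ) ∈ strip ρ) : geodCurv ρ g ε θ = geodCurv ρ g' ε θ := by
  simp only [geodCurv, christoffel_congr h _ _ _ hp, h hp]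

/-- The metric `e ^ w (f ^ 2 dθ ^ 2 + ds ^ 2)`. -/
noncomputable def conformal (f : ℝ → ℝ) (w : ℝ × ℝ → ℝ) : Tensor2 :=
  fun p => !![Real.exp (w p) * f p.2 ^ 2, 0; 0, Real.exp (w p)]

theorem conformal_inv {f : ℝ → ℝ} {w : ℝ × ℝ → ℝ} {p : ℝ × ℝ} (hf : 0 < f p.2) :
    (conformal f w p)⁻¹ =
      !![Real.exp (-w p) / f p.2 ^ 2, 0; 0, Real.exp (-w p)] := by
  refine Matrix.inv_eq_right_inv ?_
  have h1 : Real.exp (w p) * Real.exp (-w p) = 1 := by rw [← Real.exp_add]; simp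
  ext i j
  fin_cases i <;> fin_cases j <;> simp [conformal, Matrix.mul_apply, Fin.sum_univ_two, h1]
  field_simp
  exact h1

variable {f : ℝ → ℝ} {w : ℝ × ℝ → ℝ}

theorem pd_conformal (hρ : 0 < ρ) (hf : ContDiffOn ℝ 2 f (Icc (-ρ) ρ))
    (hw : ContDiffOn ℝ 2 w (strip ρ)) {p : ℝ × ℝ} (hp : p ∈ strip ρ) (a : Fin 2) :
    pd ρ a (fun q => Real.exp (w q) * f q.2 ^ 2) p = Real.exp (w p) *
      (f p.2 ^ 2 * pd ρ a w p + 2 * f p.2 * pd ρ a (fun q => f q.2) p) := by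
  have hF := (contDiffOn_comp_snd hf).differentiableOn (by norm_num) p hp
  have hwd := hw.differentiableOn (by norm_num) p hp
  simp only [pow_two]
  have hFF : DifferentiableWithinAt ℝ (fun q : ℝ × ℝ => f q.2 * f q.2) (strip ρ) p := hF.mul hF
  rw [pd_mul hρ hp a hwd.exp hFF, pd_exp hρ hp a hwd, pd_mul hρ hp a hF hF]
  ring

theorem christoffel_conformal (hρ : 0 < ρ) (hf : ContDiffOn ℝ 2 f (Icc (-ρ) ρ))
    (hfpos : ∀ s ∈ Icc (-ρ) ρ, 0 < f s) (hw : ContDiffOn ℝ 2 w (strip ρ)) {p : ℝ × ℝ}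
    (hp : p ∈ strip ρ) :
    christoffel ρ (conformal f w) 0 0 0 p = 1 / 2 * pd ρ 0 w p ∧
    christoffel ρ (conformal f w) 0 0 1 p =
      1 / 2 * pd ρ 1 w p + pd ρ 1 (fun q => f q.2) p / f p.2 ∧
    christoffel ρ (conformal f w) 0 1 0 p =
      1 / 2 * pd ρ 1 w p + pd ρ 1 (fun q => f q.2) p / f p.2 ∧
    christoffel ρ (conformal f w) 0 1 1 p = (-1 / 2) * (pd ρ 0 w p / f p.2 ^ 2) ∧
    christoffel ρ (conformal f w) 1 0 0 p =
      (-1 / 2) * (f p.2 * (f p.2 * pd ρ 1 w p)) - f p.2 * pd ρ 1 (fun q => f q.2) p ∧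
    christoffel ρ (conformal f w) 1 0 1 p = 1 / 2 * pd ρ 0 w p ∧
    christoffel ρ (conformal f w) 1 1 0 p = 1 / 2 * pd ρ 0 w p ∧
    christoffel ρ (conformal f w) 1 1 1 p = 1 / 2 * pd ρ 1 w p := by
  have hf0 := hfpos _ (mem_strip.1 hp)
  have hwd := hw.differentiableOn (by norm_num) p hp
  have hE : Real.exp (-w p) = (Real.exp (w p))⁻¹ := Real.exp_neg _
  have hpos := Real.exp_pos (w p)
  have h0 := (pd_comp_snd hρ hp (hf.differentiableOn (by norm_num) _ (mem_strip.1 hp))).1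
  have e00 : (fun q => conformal f w q 0 0) = fun q => Real.exp (w q) * f q.2 ^ 2 := by
    simp [conformal]
  have e01 : (fun q => conformal f w q 0 1) = fun _ => 0 := by simp [conformal]
  have e10 : (fun q => conformal f w q 1 0) = fun _ => 0 := by simp [conformal]
  have e11 : (fun q => conformal f w q 1 1) = fun q => Real.exp (w q) := by simp [conformal]
  simp only [christoffel, conformal_inv hf0, Fin.sum_univ_two, e00, e01, e10, e11, pd_const,
    pd_conformal hρ hf hw hp, pd_exp hρ hp _ hwd, h0, Matrix.of_apply, Matrix.cons_val', hE,
    Matrix.cons_val_zero, Matrix.cons_val_one, Matrix.cons_val_fin_one]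
  refine ⟨?_, ?_, ?_, ?_, ?_, ?_, ?_, ?_⟩ <;> field_simp <;> ring

/-- The conformal law `k = e ^ (-w / 2) (k₀ + ∂_η w / 2)`, with `k₀ = ε f' / f`. -/
theorem geodCurv_conformal (hρ : 0 < ρ) (hf : ContDiffOn ℝ 2 f (Icc (-ρ) ρ))
    (hfpos : ∀ s ∈ Icc (-ρ) ρ, 0 < f s) (hw : ContDiffOn ℝ 2 w (strip ρ)) {ε θ : ℝ}
    (hp : (θ, ε * ρ) ∈ strip ρ) :
    geodCurv ρ (conformal f w) ε θ = ε * Real.exp (-(w (θ, ε * ρ) / 2)) *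
      (pd ρ 1 w (θ, ε * ρ) / 2 + pd ρ 1 (fun q => f q.2) (θ, ε * ρ) / f (ε * ρ)) := by
  have hf0 : 0 < f (ε * ρ) := hfpos _ (mem_strip.1 hp)
  have hE : Real.exp (-w (θ, ε * ρ)) = Real.exp (-(w (θ, ε * ρ) / 2)) ^ 2 := by
    rw [← Real.exp_nat_mul]; congr 1; push_cast; ring
  have hE' : Real.exp (w (θ, ε * ρ)) = (Real.exp (-(w (θ, ε * ρ) / 2)) ^ 2)⁻¹ := by
    rw [← hE, Real.exp_neg, inv_inv]
  have hpos := Real.exp_pos (-(w (θ, ε * ρ) / 2))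
  have e00 : conformal f w (θ, ε * ρ) 0 0 = Real.exp (w (θ, ε * ρ)) * f (ε * ρ) ^ 2 := by
    simp [conformal]
  have e11 : (conformal f w (θ, ε * ρ))⁻¹ 1 1 = Real.exp (-w (θ, ε * ρ)) := by
    rw [conformal_inv hf0]; simp
  rw [geodCurv, e00, e11, (christoffel_conformal hρ hf hfpos hw hp).2.2.2.2.1, hE', hE,
    Real.sqrt_sq hpos.le]
  field_simp
  ring

/-- The conformal law `R = e ^ (-w) (R₀ - Δ₀ w)`, where `R₀ = -2 f'' / f` and `Δ₀` is the Laplacian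
of the warped metric. -/
theorem scalarCurv_conformal (hρ : 0 < ρ) (hf : ContDiffOn ℝ 2 f (Icc (-ρ) ρ))
    (hfpos : ∀ s ∈ Icc (-ρ) ρ, 0 < f s) (hw : ContDiffOn ℝ 2 w (strip ρ)) {p : ℝ × ℝ}
    (hp : p ∈ strip ρ) :
    scalarCurv ρ (conformal f w) p = Real.exp (-w p) *
      (-(pd ρ 0 (pd ρ 0 w) p / f p.2 ^ 2 + pd ρ 1 (pd ρ 1 w) p
        + pd ρ 1 (fun q => f q.2) p / f p.2 * pd ρ 1 w p)
        - 2 * (pd ρ 1 (pd ρ 1 (fun q => f q.2)) p / f p.2)) := by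
  have hf0 := hfpos _ (mem_strip.1 hp)
  have hC := fun {q} (hq : q ∈ strip ρ) => christoffel_conformal hρ hf hfpos hw hq
  have hF2 := contDiffOn_comp_snd hf
  have hF := hF2.differentiableOn (by norm_num) p hp
  have hF1 := (contDiffOn_pd hρ 1 hF2 (m := 1) (by norm_num)).differentiableOn (by norm_num) p hp
  have hw0 := (contDiffOn_pd hρ 0 hw (m := 1) (by norm_num)).differentiableOn (by norm_num) p hp
  have hw1 := (contDiffOn_pd hρ 1 hw (m := 1) (by norm_num)).differentiableOn (by norm_num) p hp
  have hF00 : pd ρ 0 (fun q => f q.2 ^ 2) p = 0 :=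
    (pd_comp_snd hρ hp (f := fun s => f s ^ 2)
      ((hf.differentiableOn (by norm_num) _ (mem_strip.1 hp)).pow 2)).1
  have hFw : DifferentiableWithinAt ℝ (fun q : ℝ × ℝ => f q.2 * pd ρ 1 w q) (strip ρ) p :=
    hF.mul hw1
  have hFFw : DifferentiableWithinAt ℝ (fun q : ℝ × ℝ => f q.2 * (f q.2 * pd ρ 1 w q))
    (strip ρ) p := hF.mul hFw
  have hFF1 : DifferentiableWithinAt ℝ
    (fun q : ℝ × ℝ => f q.2 * pd ρ 1 (fun q => f q.2) q) (strip ρ) p := hF.mul hF1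
  have hFsq : DifferentiableWithinAt ℝ (fun q : ℝ × ℝ => f q.2 ^ 2) (strip ρ) p := hF.pow 2
  have hw0F : DifferentiableWithinAt ℝ (fun q : ℝ × ℝ => pd ρ 0 w q / f q.2 ^ 2) (strip ρ) p  := by
    simpa only [div_eq_mul_inv] using hw0.fun_mul (hFsq.fun_inv (pow_ne_zero 2 hf0.ne'))
  have hF1F : DifferentiableWithinAt ℝ (fun q : ℝ × ℝ => pd ρ 1 (fun q => f q.2) q / f q.2)
    (strip ρ) p := by
    simpa only [div_eq_mul_inv] using hF1.fun_mul (hF.fun_inv hf0.ne')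
  have p1 : ∀ a, pd ρ a (christoffel ρ (conformal f w) 1 0 1) p
      = 1 / 2 * pd ρ a (pd ρ 0 w) p := fun a => by
    rw [pd_congr a (fun q hq => (hC hq).2.2.2.2.2.1) hp, pd_const_mul hρ hp a _ hw0]
  have p2 : ∀ a, pd ρ a (christoffel ρ (conformal f w) 1 0 0) p = (-1 / 2) *
      (f p.2 * (f p.2 * pd ρ a (pd ρ 1 w) p + pd ρ 1 w p * pd ρ a (fun q => f q.2) p)
        + f p.2 * pd ρ 1 w p * pd ρ a (fun q => f q.2) p)
      - (f p.2 * pd ρ a (pd ρ 1 (fun q => f q.2)) p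
        + pd ρ 1 (fun q => f q.2) p * pd ρ a (fun q => f q.2) p) := fun a => by
    rw [pd_congr a (fun q hq => (hC hq).2.2.2.2.1) hp,
      pd_sub hρ hp a (hFFw.const_mul _) hFF1, pd_const_mul hρ hp a _ hFFw, pd_mul hρ hp a hF hFw,
      pd_mul hρ hp a hF hw1, pd_mul hρ hp a hF hF1]
  have p3 : pd ρ 0 (christoffel ρ (conformal f w) 0 1 1) p
      = (-1 / 2) * (pd ρ 0 (pd ρ 0 w) p / f p.2 ^ 2) := by
    rw [pd_congr 0 (fun q hq => (hC hq).2.2.2.1) hp, pd_const_mul hρ hp 0 _ hw0F,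
      pd_div hρ hp 0 hw0 hFsq (pow_ne_zero 2 hf0.ne'), hF00]
    field_simp
    ring
  have p4 : pd ρ 1 (christoffel ρ (conformal f w) 0 1 0) p
      = 1 / 2 * pd ρ 1 (pd ρ 1 w) p + (pd ρ 1 (pd ρ 1 (fun q => f q.2)) p * f p.2
        - pd ρ 1 (fun q => f q.2) p * pd ρ 1 (fun q => f q.2) p) / f p.2 ^ 2 := by
    rw [pd_congr 1 (fun q hq => (hC hq).2.2.1) hp,
      pd_add hρ hp 1 (hw1.const_mul _) hF1F, pd_const_mul hρ hp 1 _ hw1,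
      pd_div hρ hp 1 hF1 hF hf0.ne']
  obtain ⟨c1, c2, c3, c4, c5, c6, c7, c8⟩ := hC hp
  simp only [scalarCurv, conformal_inv hf0, Fin.sum_univ_two, ricci, Matrix.of_apply,
    Matrix.cons_val', Matrix.cons_val_zero, Matrix.cons_val_one, Matrix.cons_val_fin_one,
    p1, p2, p3, p4, c1, c2, c3, c4, c5, c6, c7, c8]
  field_simp
  ring

end Geometry

/-! ### The flow as an evolution of the conformal factor -/

section Flow

variable {ρ : ℝ} {f : ℝ → ℝ} {h : ℝ → Tensor2} {S : EReal}

theorem timeInterval_mono {t τ : ℝ} (ht : t ∈ timeInterval S) (h0 : 0 ≤ τ) (hτ : τ ≤ t) :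
    τ ∈ timeInterval S :=
  ⟨h0, lt_of_le_of_lt (EReal.coe_le_coe_iff.2 hτ) ht.2⟩

theorem Icc_subset_timeInterval {t : ℝ} (ht : t ∈ timeInterval S) :
    Icc 0 t ⊆ timeInterval S := fun _ hτ => timeInterval_mono ht hτ.1 hτ.2

/-- The logarithm of the conformal factor of a flow `h t = e ^ w (f ^ 2 dθ ^ 2 + ds ^ 2)`. -/
noncomputable def logFactor (h : ℝ → Tensor2) (t : ℝ) (p : ℝ × ℝ) : ℝ := Real.log (h t p 1 1)

namespace IsRicciFlow

theorem pos (hh : IsRicciFlow ρ (warped f) h S) {t : ℝ} (ht : t ∈ timeInterval S) {p : ℝ × ℝ}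
    (hp : p ∈ strip ρ) : 0 < h t p 1 1 :=
  ((hh.isMetric t ht).posDef p hp).diag_pos

/-- At a fixed point all entries satisfy `y' = -R y`, so their quotients do not change in time. -/
theorem ratio_eq (hh : IsRicciFlow ρ (warped f) h S) {t : ℝ} (ht : t ∈ timeInterval S)
    {p : ℝ × ℝ} (hp : p ∈ strip ρ) (i j : Fin 2) :
    h t p i j / h t p 1 1 = warped f p i j := by
  rcases ht.1.eq_or_lt with h0 | h0
  · subst h0
    rw [hh.initial p hp]
    simp [warped]
  have hc : ∀ i j, ContinuousOn (fun τ => h τ p i j) (Icc 0 t) := fun i j =>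
    (hh.continuousOn i j).comp (f := fun τ : ℝ => (τ, p)) (by fun_prop)
      fun τ hτ => ⟨Icc_subset_timeInterval ht hτ, hp⟩
  have hd : ∀ τ ∈ Ioo 0 t, HasDerivAt (fun τ => h τ p i j / h τ p 1 1) 0 τ := fun τ hτ => by
    have hτ' := Icc_subset_timeInterval ht (Ioo_subset_Icc_self hτ)
    have := (hh.evolution τ hτ' hτ.1 p hp i j).div (hh.evolution τ hτ' hτ.1 p hp 1 1)
      (hh.pos hτ' hp).ne'
    refine this.congr_deriv ?_
    ring
  obtain ⟨c, hc, e⟩ := exists_hasDerivAt_eq_slope (fun τ => h τ p i j / h τ p 1 1) (fun _ => 0) h0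
    ((hc i j).div (hc 1 1) fun τ hτ => (hh.pos (Icc_subset_timeInterval ht hτ) hp).ne') hd
  have h2 : h t p i j / h t p 1 1 - h 0 p i j / h 0 p 1 1 = 0 := by
    rcases div_eq_zero_iff.1 e.symm with e | e <;> linarith
  rw [sub_eq_zero.1 h2, hh.initial p hp]
  simp [warped]

theorem eqOn_conformal (hh : IsRicciFlow ρ (warped f) h S) {t : ℝ} (ht : t ∈ timeInterval S) :
    EqOn (h t) (conformal f (logFactor h t)) (strip ρ) := by
  intro p hp
  have hpos := hh.pos ht hp
  have hr := fun i j => (div_eq_iff hpos.ne').1 (hh.ratio_eq ht hp i j)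
  have he : Real.exp (logFactor h t p) = h t p 1 1 := Real.exp_log hpos
  ext i j
  fin_cases i <;> fin_cases j
  · simpa [conformal, warped, he, mul_comm] using hr 0 0
  · simpa [conformal, warped] using hr 0 1
  · simpa [conformal, warped] using hr 1 0
  · simp [conformal, he]

theorem contDiffOn_logFactor (hh : IsRicciFlow ρ (warped f) h S) {t : ℝ}
    (ht : t ∈ timeInterval S) : ContDiffOn ℝ 2 (logFactor h t) (strip ρ) :=
  ((hh.isMetric t ht).contDiffOn 1 1).log fun _ hp => (hh.pos ht hp).ne'

theorem continuousOn_logFactor (hh : IsRicciFlow ρ (warped f) h S) :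
    ContinuousOn (fun z : ℝ × (ℝ × ℝ) => logFactor h z.1 z.2) (timeInterval S ×ˢ strip ρ) :=
  (hh.continuousOn 1 1).log fun _ hz => (hh.pos hz.1 hz.2).ne'

theorem pd_logFactor (hρ : 0 < ρ) (hh : IsRicciFlow ρ (warped f) h S) {t : ℝ}
    (ht : t ∈ timeInterval S) (a : Fin 2) :
    EqOn (pd ρ a (logFactor h t)) (fun p => pd ρ a (fun q => h t q 1 1) p / h t p 1 1)
      (strip ρ) := fun p hp =>
  pd_log hρ hp a (((hh.isMetric t ht).contDiffOn 1 1).differentiableOn (by norm_num) p hp)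
    (hh.pos ht hp).ne'

theorem continuousOn_pd_logFactor (hρ : 0 < ρ) (hh : IsRicciFlow ρ (warped f) h S) (a : Fin 2) :
    ContinuousOn (fun z : ℝ × (ℝ × ℝ) => pd ρ a (logFactor h z.1) z.2)
      (timeInterval S ×ˢ strip ρ) :=
  ((hh.continuousOn_pd 1 1 a).div (hh.continuousOn 1 1) fun _ hz => (hh.pos hz.1 hz.2).ne').congr
    fun _ hz => hh.pd_logFactor hρ hz.1 a hz.2

theorem continuousOn_pd_pd_logFactor (hρ : 0 < ρ) (hh : IsRicciFlow ρ (warped f) h S)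
    (a b : Fin 2) :
    ContinuousOn (fun z : ℝ × (ℝ × ℝ) => pd ρ a (pd ρ b (logFactor h z.1)) z.2)
      (timeInterval S ×ˢ strip ρ) := by
  refine ((((hh.continuousOn_pd_pd 1 1 a b).mul (hh.continuousOn 1 1)).sub
    ((hh.continuousOn_pd 1 1 b).mul (hh.continuousOn_pd 1 1 a))).div
    ((hh.continuousOn 1 1).pow 2) fun _ hz => pow_ne_zero 2 (hh.pos hz.1 hz.2).ne').congr ?_
  rintro ⟨t, p⟩ ⟨ht, hp⟩
  have hu := (hh.isMetric t ht).contDiffOn 1 1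
  simp only
  rw [pd_congr a (hh.pd_logFactor hρ ht b) hp, pd_div hρ hp a
    ((contDiffOn_pd hρ b hu (m := 1) (by norm_num)).differentiableOn (by norm_num) p hp)
    (hu.differentiableOn (by norm_num) p hp) (hh.pos ht hp).ne']
  rfl

theorem continuousOn_scalarCurv (hρ : 0 < ρ) (hf : ContDiffOn ℝ 2 f (Icc (-ρ) ρ))
    (hfpos : ∀ s ∈ Icc (-ρ) ρ, 0 < f s) (hh : IsRicciFlow ρ (warped f) h S) :
    ContinuousOn (fun z : ℝ × (ℝ × ℝ) => scalarCurv ρ (h z.1) z.2)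
      (timeInterval S ×ˢ strip ρ) := by
  have hF := contDiffOn_comp_snd hf
  have hF1 := contDiffOn_pd hρ 1 hF (m := 1) (by norm_num)
  have hm : MapsTo (fun z : ℝ × (ℝ × ℝ) => z.2) (timeInterval S ×ˢ strip ρ) (strip ρ) :=
    fun z hz => hz.2
  have c0 : ContinuousOn (fun z : ℝ × (ℝ × ℝ) => f z.2.2) (timeInterval S ×ˢ strip ρ) :=
    hF.continuousOn.comp continuousOn_snd hm
  have c1 : ContinuousOn (fun z : ℝ × (ℝ × ℝ) => pd ρ 1 (fun q => f q.2) z.2)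
    (timeInterval S ×ˢ strip ρ) := hF1.continuousOn.comp continuousOn_snd hm
  have c2 : ContinuousOn (fun z : ℝ × (ℝ × ℝ) => pd ρ 1 (pd ρ 1 (fun q => f q.2)) z.2)
    (timeInterval S ×ˢ strip ρ) :=
    (contDiffOn_pd hρ 1 hF1 (m := 0) (by norm_num)).continuousOn.comp continuousOn_snd hm
  have hne : ∀ z ∈ timeInterval S ×ˢ strip ρ, f z.2.2 ≠ 0 := fun z hz =>
    (hfpos _ (mem_strip.1 hz.2)).ne'
  refine (hh.continuousOn_logFactor.neg.rexp.mul
    (((((hh.continuousOn_pd_pd_logFactor hρ 0 0).div (c0.pow 2) fun z hz => pow_ne_zero 2 (hne z hz)).add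
      (hh.continuousOn_pd_pd_logFactor hρ 1 1)).add
      ((c1.div c0 hne).mul (hh.continuousOn_pd_logFactor hρ 1))).neg.sub
      ((c2.div c0 hne).const_mul 2))).congr ?_
  rintro ⟨t, p⟩ ⟨ht, hp⟩
  simp only
  rw [scalarCurv_congr (hh.eqOn_conformal ht) hp,
    scalarCurv_conformal hρ hf hfpos (hh.contDiffOn_logFactor ht) hp]
  rfl

theorem hasDerivAt_logFactor (hh : IsRicciFlow ρ (warped f) h S) {t : ℝ}
    (ht : t ∈ timeInterval S) (h0 : 0 < t) {p : ℝ × ℝ} (hp : p ∈ strip ρ) :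
    HasDerivAt (fun τ => logFactor h τ p) (-scalarCurv ρ (h t) p) t := by
  have hpos := hh.pos ht hp
  refine ((hh.evolution t ht h0 p hp 1 1).log hpos.ne').congr_deriv ?_
  field_simp

theorem logFactor_zero (hh : IsRicciFlow ρ (warped f) h S) :
    EqOn (logFactor h 0) (fun _ => 0) (strip ρ) := fun p hp => by
  simp [logFactor, hh.initial p hp, warped]

theorem geodCurv_eq (hh : IsRicciFlow ρ (warped f) h S) {t : ℝ} (ht : t ∈ timeInterval S)
    {ε : ℝ} (hε : ε = 1 ∨ ε = -1) {θ : ℝ} (hp : (θ, ε * ρ) ∈ strip ρ) :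
    geodCurv ρ (h t) ε θ = geodCurv ρ (warped f) ε θ := by
  rcases ht.1.eq_or_lt with h0 | h0
  · subst h0
    exact geodCurv_congr (fun p hp => hh.initial p hp) hp
  · rcases hε with rfl | rfl
    · exact (hh.boundary t ht h0 θ).1
    · exact (hh.boundary t ht h0 θ).2

/-- Prescribing the geodesic curvature is a nonlinear Robin condition on `w`; the sign of `k` makes
its right side monotone in `w`. -/
theorem boundary_logFactor (hρ : 0 < ρ) (hf : ContDiffOn ℝ 2 f (Icc (-ρ) ρ))
    (hfpos : ∀ s ∈ Icc (-ρ) ρ, 0 < f s) (hh : IsRicciFlow ρ (warped f) h S) {t : ℝ}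
    (ht : t ∈ timeInterval S) {ε k : ℝ} (hε : ε = 1 ∨ ε = -1)
    (hk : ∀ θ, geodCurv ρ (warped f) ε θ = k) (θ : ℝ) :
    ε * (pd ρ 1 (logFactor h t) (θ, ε * ρ) +
      2 * (derivWithin f (Icc (-ρ) ρ) (ε * ρ) / f (ε * ρ))) =
      2 * k * Real.exp (logFactor h t (θ, ε * ρ) / 2) := by
  have hp : (θ, ε * ρ) ∈ strip ρ := by
    rw [mem_strip]
    rcases hε with rfl | rfl <;> constructor <;> simp <;> linarith
  have e := hh.geodCurv_eq ht hε hp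
  rw [hk, geodCurv_congr (hh.eqOn_conformal ht) hp,
    geodCurv_conformal hρ hf hfpos (hh.contDiffOn_logFactor ht) hp,
    (pd_comp_snd hρ hp (hf.differentiableOn (by norm_num) _ (mem_strip.1 hp))).2, Real.exp_neg] at e
  rw [← e]
  have := Real.exp_pos (logFactor h t (θ, ε * ρ) / 2)
  field_simp

theorem logFactor_periodic (hh : IsRicciFlow ρ (warped f) h S) {t : ℝ} (ht : t ∈ timeInterval S)
    {s : ℝ} (hs : s ∈ Icc (-ρ) ρ) :
    Function.Periodic (fun θ => logFactor h t (θ, s)) (2 * Real.pi) := fun θ => by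
  simp only [logFactor]
  rw [(hh.isMetric t ht).periodic (θ, s) (mem_strip.2 hs)]

end IsRicciFlow

end Flow

/-! ### One-sided derivative tests at a maximum -/

section MaximumPrinciple

theorem nonneg_of_isMax_right {φ : ℝ → ℝ} {d t : ℝ} (ht : 0 < t) (hd : HasDerivAt φ d t)
    (hmax : ∀ τ ∈ Icc 0 t, φ τ ≤ φ t) : 0 ≤ d := by
  have hm : IsLocalMaxOn φ (Icc 0 t) t := (isMaxOn_iff.2 hmax).localize
  have hy : -t ∈ posTangentConeAt (Icc 0 t) t := mem_posTangentConeAt_of_segment_subset (by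
    rw [segment_symm, segment_eq_Icc (by linarith)]
    exact Icc_subset_Icc (by linarith) le_rfl)
  have := hm.hasFDerivWithinAt_nonpos hd.hasFDerivAt.hasFDerivWithinAt hy
  simp at this
  nlinarith

/-- The maximum may be an endpoint, so `ψ' 0 = 0` has to be assumed. If `c > 0`, then `ψ'` is
positive just to the right of `0`, which contradicts the mean value theorem. -/
theorem second_deriv_nonpos_of_isMax_left {ψ ψ' : ℝ → ℝ} {c : ℝ}
    (h1 : ∀ t ∈ Icc (0 : ℝ) 1, HasDerivWithinAt ψ (ψ' t) (Icc 0 1) t)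
    (h2 : HasDerivWithinAt ψ' c (Icc 0 1) 0) (h0 : ψ' 0 = 0)
    (hmax : ∀ t ∈ Icc (0 : ℝ) 1, ψ t ≤ ψ 0) : c ≤ 0 := by
  by_contra! hc
  have hs := hasDerivWithinAt_iff_tendsto_slope.1 h2
  have hev := hs.eventually (lt_mem_nhds hc)
  rw [eventually_nhdsWithin_iff, Metric.eventually_nhds_iff] at hev
  obtain ⟨δ, hδ, hev⟩ := hev
  set b := min (δ / 2) 1 with hb
  have hb0 : 0 < b := by positivity
  have hb1 : b ≤ 1 := min_le_right _ _
  have hbδ : b < δ := (min_le_left _ _).trans_lt (by linarith)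
  obtain ⟨ξ, hξ, e⟩ := exists_hasDerivAt_eq_slope ψ ψ' hb0
    (fun t ht => ((h1 t ⟨ht.1, ht.2.trans hb1⟩).continuousWithinAt).mono (Icc_subset_Icc le_rfl hb1))
    fun t ht => (h1 t ⟨ht.1.le, ht.2.le.trans hb1⟩).hasDerivAt
      (Icc_mem_nhds ht.1 (ht.2.trans_le hb1))
  have h3 := hev (y := ξ) (by
    rw [Real.dist_eq, sub_zero, abs_of_pos hξ.1]; exact hξ.2.trans hbδ)
    ⟨⟨hξ.1.le, hξ.2.le.trans hb1⟩, hξ.1.ne'⟩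
  rw [slope_def_field, h0, sub_zero, sub_zero, e] at h3
  have h4 : (ψ b - ψ 0) / (b - 0) ≤ 0 :=
    div_nonpos_of_nonpos_of_nonneg (sub_nonpos.2 (hmax b ⟨hb0.le, hb1⟩)) (by linarith)
  exact absurd h3 (not_lt.2 (div_nonpos_of_nonpos_of_nonneg h4 hξ.1.le))

variable {ρ : ℝ} {z : ℝ × ℝ → ℝ} {p : ℝ × ℝ}

theorem pd_mul_nonpos_of_isMaxOn (hz : DifferentiableWithinAt ℝ z (strip ρ) p)
    (hmax : IsMaxOn z (strip ρ) p) (i : Fin 2) {d : ℝ}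
    (hd : segment ℝ p (p + d • coordVec i) ⊆ strip ρ) : d * pd ρ i z p ≤ 0 := by
  have := hmax.localize.hasFDerivWithinAt_nonpos hz.hasFDerivWithinAt
    (mem_posTangentConeAt_of_segment_subset hd)
  simpa [pd] using this

theorem pd_pd_nonpos_of_isMaxOn (hρ : 0 < ρ) (hz : ContDiffOn ℝ 2 z (strip ρ))
    (hmax : IsMaxOn z (strip ρ) p) (i : Fin 2) {d : ℝ} (hd0 : d ≠ 0)
    (hd : segment ℝ p (p + d • coordVec i) ⊆ strip ρ) (h0 : pd ρ i z p = 0) :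
    pd ρ i (pd ρ i z) p ≤ 0 := by
  have hm : MapsTo (fun t : ℝ => p + t • d • coordVec i) (Icc 0 1) (strip ρ) := fun t ht => by
    refine hd ?_
    rw [segment_eq_image']
    exact ⟨t, ht, by simp⟩
  have hl : ∀ t, HasDerivWithinAt (fun t : ℝ => p + t • d • coordVec i) (d • coordVec i)
      (Icc 0 1) t := fun t => by
    simpa using (((hasDerivAt_id t).smul_const (d • coordVec i)).const_add p).hasDerivWithinAt
  have key : ∀ u : ℝ × ℝ → ℝ, DifferentiableOn ℝ u (strip ρ) → ∀ t ∈ Icc (0 : ℝ) 1,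
      HasDerivWithinAt (fun t : ℝ => u (p + t • d • coordVec i))
        (d * pd ρ i u (p + t • d • coordVec i)) (Icc 0 1) t := fun u hu t ht => by
    have := (hu _ (hm ht)).hasFDerivWithinAt.comp_hasDerivWithinAt
      (f := fun t : ℝ => p + t • d • coordVec i) t (hl t) hm
    simpa [pd, Function.comp_def] using this
  have h1 := key z (hz.differentiableOn (by norm_num))
  have h2 := (key _ ((contDiffOn_pd hρ i hz (m := 1) (by norm_num)).differentiableOn
    (by norm_num)) 0 (by simp)).const_mul d
  have := second_deriv_nonpos_of_isMax_left h1 h2 (by simp [h0])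
    fun t ht => by simpa using hmax (hm ht)
  simp only [zero_smul, add_zero, ← mul_assoc] at this
  exact nonpos_of_mul_nonpos_right this (mul_self_pos.2 hd0)

/-- First and second order conditions at a maximum at which the outward derivative, if the
maximum is at the boundary, is not positive. -/
theorem derivatives_of_isMaxOn (hρ : 0 < ρ) (hz : ContDiffOn ℝ 2 z (strip ρ)) (hp : p ∈ strip ρ)
    (hmax : IsMaxOn z (strip ρ) p) (hright : p.2 = ρ → pd ρ 1 z p ≤ 0)
    (hleft : p.2 = -ρ → 0 ≤ pd ρ 1 z p) :
    pd ρ 1 z p = 0 ∧ pd ρ 0 (pd ρ 0 z) p ≤ 0 ∧ pd ρ 1 (pd ρ 1 z) p ≤ 0 := by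
  have hconv : Convex ℝ (strip ρ) := convex_univ.prod (convex_Icc _ _)
  have hp' := mem_strip.1 hp
  have hd := hz.differentiableOn (by norm_num) p hp
  have s0 : ∀ d : ℝ, segment ℝ p (p + d • coordVec 0) ⊆ strip ρ := fun d =>
    hconv.segment_subset hp (by rw [mem_strip]; simpa [coordVec] using hp')
  have s1 : ∀ s ∈ Icc (-ρ) ρ, segment ℝ p (p + (s - p.2) • coordVec 1) ⊆ strip ρ := fun s hs =>
    hconv.segment_subset hp (by rw [mem_strip]; simpa [coordVec] using hs)
  have a1 := pd_mul_nonpos_of_isMaxOn hd hmax 0 (s0 1)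
  have a2 := pd_mul_nonpos_of_isMaxOn hd hmax 0 (s0 (-1))
  have b1 := pd_mul_nonpos_of_isMaxOn hd hmax 1 (s1 ρ ⟨by linarith, le_rfl⟩)
  have b2 := pd_mul_nonpos_of_isMaxOn hd hmax 1 (s1 (-ρ) ⟨le_rfl, by linarith⟩)
  have h1 : pd ρ 1 z p = 0 := by
    refine le_antisymm ?_ ?_
    · rcases hp'.2.eq_or_lt with e | e
      · exact hright e
      · exact nonpos_of_mul_nonpos_right b1 (sub_pos.2 e)
    · rcases hp'.1.eq_or_lt with e | e
      · exact hleft e.symm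
      · nlinarith
  refine ⟨h1, pd_pd_nonpos_of_isMaxOn hρ hz hmax 0 one_ne_zero (s0 1) (by linarith), ?_⟩
  -- The second-order test needs a segment of nonzero length: inwards from the right end, and
  -- towards the right end from elsewhere.
  by_cases e : p.2 = ρ
  · exact pd_pd_nonpos_of_isMaxOn hρ hz hmax 1 (by linarith : -ρ - p.2 ≠ 0)
      (s1 (-ρ) ⟨le_rfl, by linarith⟩) h1
  · exact pd_pd_nonpos_of_isMaxOn hρ hz hmax 1 (sub_ne_zero.2 (Ne.symm e))
      (s1 ρ ⟨by linarith, le_rfl⟩) h1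

end MaximumPrinciple

/-! ### Rotational symmetry is preserved -/

section Symmetry

variable {ρ : ℝ} {f : ℝ → ℝ} {h : ℝ → Tensor2} {S : EReal} {k₁ k₂ : ℝ}

/-- A comparison of `h` with its rotation by the angle `α`, by the maximum principle. -/
theorem IsRicciFlow.logFactor_le_rotate (hρ : 0 < ρ) (hf : ContDiffOn ℝ 2 f (Icc (-ρ) ρ))
    (hfpos : ∀ s ∈ Icc (-ρ) ρ, 0 < f s) (hk₁ : ∀ θ, geodCurv ρ (warped f) (-1) θ = k₁)
    (hk₂ : ∀ θ, geodCurv ρ (warped f) 1 θ = k₂) (hk₁_nonpos : k₁ ≤ 0) (hk₂_nonpos : k₂ ≤ 0)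
    (hh : IsRicciFlow ρ (warped f) h S) {t : ℝ} (ht : t ∈ timeInterval S) (α : ℝ)
    {p : ℝ × ℝ} (hp : p ∈ strip ρ) : logFactor h t p ≤ logFactor h t (p.1 + α, p.2) := by
  -- One period in `θ` suffices by periodicity, and makes the domain compact.
  set K : Set (ℝ × (ℝ × ℝ)) := Icc 0 t ×ˢ (Icc 0 (2 * Real.pi) ×ˢ Icc (-ρ) ρ) with hK
  have hKc : IsCompact K := isCompact_Icc.prod (isCompact_Icc.prod isCompact_Icc)
  have hKs : K ⊆ timeInterval S ×ˢ strip ρ := fun x hx =>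
    ⟨Icc_subset_timeInterval ht hx.1, mem_strip.2 hx.2.2⟩
  have hrot : ContinuousOn (fun x : ℝ × (ℝ × ℝ) => (x.1, (x.2.1 + α, x.2.2))) K := by fun_prop
  have hrotm : MapsTo (fun x : ℝ × (ℝ × ℝ) => (x.1, (x.2.1 + α, x.2.2))) K
      (timeInterval S ×ˢ strip ρ) := fun x hx => ⟨(hKs hx).1, mem_strip.2 hx.2.2⟩
  obtain ⟨B, hB⟩ := hKc.exists_bound_of_continuousOn
    ((hh.continuousOn_scalarCurv hρ hf hfpos).comp hrot hrotm)
  -- The damping `e ^ (-C τ)` must strictly beat the zeroth-order term, which is at most `|B| z` at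
  -- a positive maximum.
  set C := |B| + 1 with hC
  set z : ℝ → ℝ × ℝ → ℝ := fun τ q => logFactor h τ q - logFactor h τ (q.1 + α, q.2) with hz
  have hvc : ContinuousOn (fun x : ℝ × (ℝ × ℝ) => Real.exp (-(C * x.1)) * z x.1 x.2) K :=
    ContinuousOn.mul (by fun_prop) ((hh.continuousOn_logFactor.mono hKs).sub
      (hh.continuousOn_logFactor.comp hrot hrotm))
  have hpi := Real.pi_pos
  have hred : ∀ τ ∈ timeInterval S, ∀ q ∈ strip ρ, ∃ θ ∈ Icc 0 (2 * Real.pi),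
      z τ q = z τ (θ, q.2) := fun τ hτ q hq => by
    have hper := hh.logFactor_periodic hτ (mem_strip.1 hq)
    have hper' : Function.Periodic (fun θ => z τ (θ, q.2)) (2 * Real.pi) := fun θ => by
      have h1 := hper θ
      have h2 := hper (θ + α)
      simp only at h1 h2
      simp only [hz, h1]
      rw [← h2]
      congr 3
      ring
    obtain ⟨θ, hθ, e⟩ := hper'.exists_mem_Ico₀ (by linarith) q.1
    exact ⟨θ, Ico_subset_Icc_self hθ, e⟩
  obtain ⟨⟨τ, q⟩, hx, hxmax⟩ := hKc.exists_isMaxOn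
    ⟨(0, (0, 0)), ⟨⟨le_rfl, ht.1⟩, ⟨le_rfl, by linarith⟩, ⟨by linarith, hρ.le⟩⟩⟩ hvc
  have hτ : τ ∈ timeInterval S := (hKs hx).1
  have hq : q ∈ strip ρ := (hKs hx).2
  set q' : ℝ × ℝ := (q.1 + α, q.2) with hq'
  have hqs' : q' ∈ strip ρ := mem_strip.2 (mem_strip.1 hq)
  suffices hle : z τ q ≤ 0 by
    obtain ⟨θ, hθ, e⟩ := hred t ht p hp
    have h1 : Real.exp (-(C * t)) * z t (θ, p.2) ≤ Real.exp (-(C * τ)) * z τ q :=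
      hxmax (a := (t, (θ, p.2))) ⟨⟨ht.1, le_rfl⟩, hθ, mem_strip.1 hp⟩
    have h2 := h1.trans (mul_nonpos_of_nonneg_of_nonpos (Real.exp_pos _).le hle)
    have h3 := nonpos_of_mul_nonpos_right h2 (Real.exp_pos _)
    rw [← e] at h3
    exact sub_nonpos.1 h3
  by_contra! hpos
  have hτ0 : 0 < τ := by
    refine hτ.1.lt_of_ne fun e => ?_
    subst e
    have e' : logFactor h 0 (q.1 + α, q.2) = 0 := hh.logFactor_zero hqs'
    simp [hz, hh.logFactor_zero hq, e'] at hpos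
  have hmax : IsMaxOn (z τ) (strip ρ) q := isMaxOn_iff.2 fun r hr => by
    obtain ⟨θ, hθ, e⟩ := hred τ hτ r hr
    rw [e]
    exact le_of_mul_le_mul_left (hxmax (a := (τ, (θ, r.2))) ⟨hx.1, hθ, mem_strip.1 hr⟩)
      (Real.exp_pos _)
  have hw := hh.contDiffOn_logFactor hτ
  have hw' : ContDiffOn ℝ 2 (fun q : ℝ × ℝ => logFactor h τ (q.1 + α, q.2)) (strip ρ) :=
    hw.comp (f := fun q : ℝ × ℝ => (q.1 + α, q.2)) (by fun_prop) fun r hr =>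
      mem_strip.2 (mem_strip.1 hr)
  have pz : ∀ i, ∀ r ∈ strip ρ, pd ρ i (z τ) r =
      pd ρ i (logFactor h τ) r - pd ρ i (logFactor h τ) (r.1 + α, r.2) := fun i r hr => by
    rw [← pd_rotate]
    exact pd_sub hρ hr i (hw.differentiableOn (by norm_num) r hr)
      (hw'.differentiableOn (by norm_num) r hr)
  have ppz : ∀ i, pd ρ i (pd ρ i (z τ)) q =
      pd ρ i (pd ρ i (logFactor h τ)) q - pd ρ i (pd ρ i (logFactor h τ)) q' := fun i => by
    have d1 := contDiffOn_pd hρ i hw (m := 1) (by norm_num)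
    have d2 : ContDiffOn ℝ 1 (fun q : ℝ × ℝ => pd ρ i (logFactor h τ) (q.1 + α, q.2)) (strip ρ) :=
      d1.comp (f := fun q : ℝ × ℝ => (q.1 + α, q.2)) (by fun_prop) fun r hr =>
        mem_strip.2 (mem_strip.1 hr)
    rw [pd_congr i (fun r hr => pz i r hr) hq, ← pd_rotate (u := pd ρ i (logFactor h τ))]
    exact pd_sub hρ hq i (d1.differentiableOn (by norm_num) q hq)
      (d2.differentiableOn (by norm_num) q hq)
  have hexp : ∀ θ s, (θ, s) = q →
      Real.exp (logFactor h τ (θ + α, s) / 2) ≤ Real.exp (logFactor h τ (θ, s) / 2) := by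
    rintro θ s rfl
    refine Real.exp_le_exp.2 ?_
    have := hpos
    simp only [hz] at this
    linarith
  -- Subtracting the two Robin conditions gives `∂_η z = 2 k (e ^ (w / 2) - e ^ (w' / 2))`, with
  -- `w'` the rotated factor; here `w > w'` and `k ≤ 0`.
  have hright : q.2 = ρ → pd ρ 1 (z τ) q ≤ 0 := fun e => by
    have eq : q = (q.1, ρ) := by rw [← e]
    have b1 := hh.boundary_logFactor hρ hf hfpos hτ (Or.inl rfl) hk₂ q.1
    have b2 := hh.boundary_logFactor hρ hf hfpos hτ (Or.inl rfl) hk₂ (q.1 + α)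
    have := hexp q.1 ρ eq.symm
    rw [pz 1 q hq, e]
    simp only [one_mul] at b1 b2
    rw [← eq] at b1 this
    nlinarith
  have hleft : q.2 = -ρ → 0 ≤ pd ρ 1 (z τ) q := fun e => by
    have eq : q = (q.1, -ρ) := by rw [← e]
    have b1 := hh.boundary_logFactor hρ hf hfpos hτ (Or.inr rfl) hk₁ q.1
    have b2 := hh.boundary_logFactor hρ hf hfpos hτ (Or.inr rfl) hk₁ (q.1 + α)
    have := hexp q.1 (-ρ) eq.symm
    rw [pz 1 q hq, e]
    simp only [neg_one_mul] at b1 b2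
    rw [← eq] at b1 this
    nlinarith
  obtain ⟨z1, z00, z11⟩ := derivatives_of_isMaxOn hρ ((hw.sub hw' : ContDiffOn ℝ 2 (z τ) _)) hq
    hmax hright hleft
  rw [pz 1 q hq] at z1
  rw [ppz] at z00 z11
  have hRq := scalarCurv_congr (hh.eqOn_conformal hτ) hq
  have hRq' := scalarCurv_congr (hh.eqOn_conformal hτ) hqs'
  rw [scalarCurv_conformal hρ hf hfpos hw hq] at hRq
  rw [scalarCurv_conformal hρ hf hfpos hw hqs'] at hRq'
  have f1 : ∀ r : ℝ × ℝ, pd ρ 1 (fun q => f q.2) (r.1 + α, r.2) = pd ρ 1 (fun q => f q.2) r :=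
    fun r => (pd_rotate (u := fun q : ℝ × ℝ => f q.2) 1 α).symm
  have f2 : pd ρ 1 (pd ρ 1 (fun q => f q.2)) q' = pd ρ 1 (pd ρ 1 (fun q => f q.2)) q := by
    rw [hq', ← pd_rotate (u := pd ρ 1 fun q => f q.2)]
    simp only [f1]
  rw [f1 q, f2, show pd ρ 1 (logFactor h τ) q' = pd ρ 1 (logFactor h τ) q by linarith] at hRq'
  have hf0 : 0 < f q.2 := hfpos _ (mem_strip.1 hq)
  -- `e ^ w R = R₀ - Δ₀ w`, where `R₀` is rotation invariant and `Δ₀ z ≤ 0` at the maximum.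
  have hineq : Real.exp (logFactor h τ q') * scalarCurv ρ (h τ) q' ≤
      Real.exp (logFactor h τ q) * scalarCurv ρ (h τ) q := by
    rw [hRq, hRq', ← mul_assoc, ← mul_assoc, ← Real.exp_add, ← Real.exp_add]
    simp only [add_neg_cancel, Real.exp_zero, one_mul, hq']
    have : pd ρ 0 (pd ρ 0 (logFactor h τ)) q / f q.2 ^ 2 ≤
        pd ρ 0 (pd ρ 0 (logFactor h τ)) (q.1 + α, q.2) / f q.2 ^ 2 := by
      gcongr
      linarith
    linarith
  have hE : Real.exp (logFactor h τ q') = Real.exp (logFactor h τ q) * Real.exp (-z τ q) := by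
    rw [← Real.exp_add]; congr 1; simp only [hz]; ring
  rw [hE, mul_assoc] at hineq
  have hR := le_of_mul_le_mul_left hineq (Real.exp_pos _)
  have hBq : |scalarCurv ρ (h τ) q'| ≤ B := hB (τ, q) hx
  have hder : HasDerivAt (fun σ => Real.exp (-(C * σ)) * z σ q)
      (Real.exp (-(C * τ)) * (scalarCurv ρ (h τ) q' - scalarCurv ρ (h τ) q - C * z τ q)) τ := by
    have e1 : HasDerivAt (fun σ => Real.exp (-(C * σ))) (Real.exp (-(C * τ)) * (-(C * 1))) τ :=
      (((hasDerivAt_id τ).const_mul C).neg).exp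
    refine (e1.mul ((hh.hasDerivAt_logFactor hτ hτ0 hq).sub
      (hh.hasDerivAt_logFactor hτ hτ0 hqs'))).congr_deriv ?_
    simp only [hz, hq', Pi.sub_apply]
    ring
  -- Maximality in time gives `R' - R ≥ C z`, with `R'` the curvature at `q'`. But `hR` gives `R' -
  -- R ≤ R' (1 - e ^ (-z)) ≤ |B| z`, a contradiction for `z > 0`.
  have h5 := nonneg_of_isMax_right hτ0 hder fun σ hσ =>
    hxmax (a := (σ, q)) ⟨⟨hσ.1, hσ.2.trans hx.1.2⟩, hx.2⟩
  have h6 := nonneg_of_mul_nonneg_right h5 (Real.exp_pos _)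
  have h7 : 1 - Real.exp (-z τ q) ≤ z τ q := by
    have := Real.add_one_le_exp (-z τ q); linarith
  have h8 : 0 ≤ 1 - Real.exp (-z τ q) := by
    have := Real.exp_le_one_iff.2 (neg_nonpos.2 hpos.le); linarith
  have h9 : scalarCurv ρ (h τ) q' * (1 - Real.exp (-z τ q)) ≤ |B| * z τ q :=
    mul_le_mul (((le_abs_self _).trans hBq).trans (le_abs_self B)) h7 h8 (abs_nonneg B)
  rw [hC] at h6
  linarith

theorem IsRicciFlow.logFactor_rotate (hρ : 0 < ρ) (hf : ContDiffOn ℝ 2 f (Icc (-ρ) ρ))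
    (hfpos : ∀ s ∈ Icc (-ρ) ρ, 0 < f s) (hk₁ : ∀ θ, geodCurv ρ (warped f) (-1) θ = k₁)
    (hk₂ : ∀ θ, geodCurv ρ (warped f) 1 θ = k₂) (hk₁_nonpos : k₁ ≤ 0) (hk₂_nonpos : k₂ ≤ 0)
    (hh : IsRicciFlow ρ (warped f) h S) {t : ℝ} (ht : t ∈ timeInterval S)
    {s : ℝ} (hs : s ∈ Icc (-ρ) ρ) (θ : ℝ) : logFactor h t (θ, s) = logFactor h t (0, s) := by
  have key := fun θ₁ θ₂ : ℝ => hh.logFactor_le_rotate hρ hf hfpos hk₁ hk₂ hk₁_nonpos hk₂_nonpos ht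
    (θ₂ - θ₁) (p := (θ₁, s)) (mem_strip.2 hs)
  simp only [add_sub_cancel] at key
  exact le_antisymm (key θ 0) (key 0 θ)

end Symmetry

/-! ### Rotationally symmetric metrics: Gauss–Bonnet and area -/

section Profile

variable {ρ : ℝ} {f W : ℝ → ℝ}

theorem contDiffOn_derivWithin_Icc (hρ : 0 < ρ) {m n : WithTop ℕ∞}
    (hW : ContDiffOn ℝ n W (Icc (-ρ) ρ)) (hmn : m + 1 ≤ n) :
    ContDiffOn ℝ m (derivWithin W (Icc (-ρ) ρ)) (Icc (-ρ) ρ) :=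
  hW.derivWithin (uniqueDiffOn_Icc (by linarith)) hmn

theorem pd_pd_comp_snd (hρ : 0 < ρ) (hW : ContDiffOn ℝ 2 W (Icc (-ρ) ρ)) {p : ℝ × ℝ}
    (hp : p ∈ strip ρ) :
    pd ρ 0 (pd ρ 0 (fun q => W q.2)) p = 0 ∧ pd ρ 1 (pd ρ 1 (fun q => W q.2)) p =
      derivWithin (derivWithin W (Icc (-ρ) ρ)) (Icc (-ρ) ρ) p.2 := by
  have e := fun q (hq : q ∈ strip ρ) =>
    pd_comp_snd hρ hq (hW.differentiableOn (by norm_num) _ (mem_strip.1 hq))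
  constructor
  · rw [pd_congr 0 (fun q hq => (e q hq).1) hp, pd_const]
  · rw [pd_congr 1 (fun q hq => (e q hq).2) hp]
    exact (pd_comp_snd hρ hp ((contDiffOn_derivWithin_Icc hρ hW (m := 1)
      (by norm_num)).differentiableOn (by norm_num) _ (mem_strip.1 hp))).2

theorem scalarCurv_conformal_comp_snd (hρ : 0 < ρ) (hf : ContDiffOn ℝ 2 f (Icc (-ρ) ρ))
    (hfpos : ∀ s ∈ Icc (-ρ) ρ, 0 < f s) (hW : ContDiffOn ℝ 2 W (Icc (-ρ) ρ)) {p : ℝ × ℝ}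
    (hp : p ∈ strip ρ) :
    scalarCurv ρ (conformal f fun q => W q.2) p = Real.exp (-W p.2) *
      (-(derivWithin (derivWithin W (Icc (-ρ) ρ)) (Icc (-ρ) ρ) p.2
        + derivWithin f (Icc (-ρ) ρ) p.2 / f p.2 * derivWithin W (Icc (-ρ) ρ) p.2)
        - 2 * (derivWithin (derivWithin f (Icc (-ρ) ρ)) (Icc (-ρ) ρ) p.2 / f p.2)) := by
  rw [scalarCurv_conformal hρ hf hfpos (contDiffOn_comp_snd hW) hp,
    (pd_pd_comp_snd hρ hW hp).1, (pd_pd_comp_snd hρ hW hp).2, (pd_pd_comp_snd hρ hf hp).2,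
    (pd_comp_snd hρ hp (hW.differentiableOn (by norm_num) _ (mem_strip.1 hp))).2,
    (pd_comp_snd hρ hp (hf.differentiableOn (by norm_num) _ (mem_strip.1 hp))).2]
  simp

theorem continuousOn_scalarCurv_conformal_comp_snd (hρ : 0 < ρ)
    (hf : ContDiffOn ℝ 2 f (Icc (-ρ) ρ)) (hfpos : ∀ s ∈ Icc (-ρ) ρ, 0 < f s)
    (hW : ContDiffOn ℝ 2 W (Icc (-ρ) ρ)) :
    ContinuousOn (fun s => scalarCurv ρ (conformal f fun q => W q.2) (0, s)) (Icc (-ρ) ρ) := by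
  have c1 := fun {u : ℝ → ℝ} (hu : ContDiffOn ℝ 2 u (Icc (-ρ) ρ)) =>
    contDiffOn_derivWithin_Icc hρ hu (m := 1) (by norm_num)
  have c2 := fun {u : ℝ → ℝ} (hu : ContDiffOn ℝ 2 u (Icc (-ρ) ρ)) =>
    contDiffOn_derivWithin_Icc hρ (c1 hu) (m := 0) (by norm_num)
  have hne : ∀ s ∈ Icc (-ρ) ρ, f s ≠ 0 := fun s hs => (hfpos s hs).ne'
  refine (hW.continuousOn.neg.rexp.mul
    ((((c2 hW).continuousOn.add (((c1 hf).continuousOn.div hf.continuousOn hne).mul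
      (c1 hW).continuousOn)).neg.sub
      (((c2 hf).continuousOn.div hf.continuousOn hne).const_mul 2)))).congr fun s hs => ?_
  rw [scalarCurv_conformal_comp_snd hρ hf hfpos hW (mem_strip.2 hs)]
  rfl

/-- The Gauss-Bonnet formula for rotationally symmetric metrics. -/
theorem integral_scalarCurv (hρ : 0 < ρ) (hf : ContDiffOn ℝ 2 f (Icc (-ρ) ρ))
    (hfpos : ∀ s ∈ Icc (-ρ) ρ, 0 < f s) (hW : ContDiffOn ℝ 2 W (Icc (-ρ) ρ)) :
    ∫ s in (-ρ)..ρ, scalarCurv ρ (conformal f fun q => W q.2) (0, s) * (Real.exp (W s) * f s) =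
      f (-ρ) * (derivWithin W (Icc (-ρ) ρ) (-ρ) + 2 * (derivWithin f (Icc (-ρ) ρ) (-ρ) / f (-ρ)))
      - f ρ * (derivWithin W (Icc (-ρ) ρ) ρ + 2 * (derivWithin f (Icc (-ρ) ρ) ρ / f ρ)) := by
  have hd := fun {u : ℝ → ℝ} (hu : ContDiffOn ℝ 1 u (Icc (-ρ) ρ)) {s : ℝ} (hs : s ∈ Ioo (-ρ) ρ) =>
    (hu.differentiableOn (by norm_num) s (Ioo_subset_Icc_self hs)).hasDerivWithinAt.hasDerivAt
      (Icc_mem_nhds hs.1 hs.2)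
  have c1 := fun {u : ℝ → ℝ} (hu : ContDiffOn ℝ 2 u (Icc (-ρ) ρ)) =>
    contDiffOn_derivWithin_Icc hρ hu (m := 1) (by norm_num)
  have hle : -ρ ≤ ρ := by linarith
  -- In the symmetric case the curvature density is exact: `R e ^ W f = -(f W' + 2 f')'`.
  have hint := intervalIntegral.integral_eq_sub_of_hasDerivAt_of_le hle
    (f := fun s => -(f s * derivWithin W (Icc (-ρ) ρ) s + 2 * derivWithin f (Icc (-ρ) ρ) s))
    (f' := fun s => scalarCurv ρ (conformal f fun q => W q.2) (0, s) * (Real.exp (W s) * f s))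
    ((hf.continuousOn.mul (c1 hW).continuousOn).add ((c1 hf).continuousOn.const_mul 2)).neg
    (fun s hs => by
      have hs' := Ioo_subset_Icc_self hs
      have hf0 := hfpos s hs'
      refine ((((hd (hf.of_le (by norm_num)) hs).mul (hd (c1 hW) hs)).add
        ((hd (c1 hf) hs).const_mul 2)).neg).congr_deriv ?_
      rw [scalarCurv_conformal_comp_snd hρ hf hfpos hW (mem_strip.2 hs'), Real.exp_neg]
      have := Real.exp_pos (W s)
      field_simp
      ring)
    (ContinuousOn.intervalIntegrable_of_Icc hle
      ((continuousOn_scalarCurv_conformal_comp_snd hρ hf hfpos hW).mul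
        (hW.continuousOn.rexp.mul hf.continuousOn)))
  rw [hint]
  have h1 := (hfpos ρ ⟨hle, le_rfl⟩).ne'
  have h2 := (hfpos (-ρ) ⟨le_rfl, hle⟩).ne'
  field_simp
  ring

theorem area_congr {g g' : Tensor2} (hρ : 0 < ρ) (h : EqOn g g' (strip ρ)) :
    area ρ g = area ρ g' := by
  refine intervalIntegral.integral_congr fun s hs => ?_
  rw [uIcc_of_le (by linarith)] at hs
  simp only [fun θ : ℝ => h (mem_strip.2 hs : (θ, s) ∈ strip ρ)]

theorem area_conformal_comp_snd (hρ : 0 < ρ) (hfpos : ∀ s ∈ Icc (-ρ) ρ, 0 < f s) :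
    area ρ (conformal f fun q => W q.2) = 2 * Real.pi * ∫ s in (-ρ)..ρ, Real.exp (W s) * f s := by
  rw [area, ← intervalIntegral.integral_const_mul]
  refine intervalIntegral.integral_congr fun s hs => ?_
  rw [uIcc_of_le (by linarith)] at hs
  have e : Real.exp (W s) * f s ^ 2 * Real.exp (W s) = (Real.exp (W s) * f s) ^ 2 := by ring
  simp [conformal, Matrix.det_fin_two, e,
    Real.sqrt_sq (mul_pos (Real.exp_pos _) (hfpos s hs)).le]
  ring

theorem area_conformal_comp_snd_pos (hρ : 0 < ρ) (hf : ContinuousOn f (Icc (-ρ) ρ))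
    (hfpos : ∀ s ∈ Icc (-ρ) ρ, 0 < f s) (hW : ContinuousOn W (Icc (-ρ) ρ)) :
    0 < area ρ (conformal f fun q => W q.2) := by
  rw [area_conformal_comp_snd hρ hfpos]
  have := Real.pi_pos
  refine mul_pos (by positivity) (intervalIntegral.intervalIntegral_pos_of_pos_on
    (ContinuousOn.intervalIntegrable_of_Icc (by linarith) (hW.rexp.mul hf))
    (fun s hs => mul_pos (Real.exp_pos _) (hfpos s (Ioo_subset_Icc_self hs))) (by linarith))

theorem image_scalarCurv_conformal_comp_snd (hρ : 0 < ρ) (hf : ContDiffOn ℝ 2 f (Icc (-ρ) ρ))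
    (hfpos : ∀ s ∈ Icc (-ρ) ρ, 0 < f s) (hW : ContDiffOn ℝ 2 W (Icc (-ρ) ρ)) :
    scalarCurv ρ (conformal f fun q => W q.2) '' strip ρ =
      (fun s => scalarCurv ρ (conformal f fun q => W q.2) (0, s)) '' Icc (-ρ) ρ := by
  ext x
  constructor
  · rintro ⟨p, hp, rfl⟩
    refine ⟨p.2, mem_strip.1 hp, ?_⟩
    simp only
    rw [scalarCurv_conformal_comp_snd hρ hf hfpos hW hp,
      scalarCurv_conformal_comp_snd hρ hf hfpos hW (p := (0, p.2)) (mem_strip.2 (mem_strip.1 hp))]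
  · rintro ⟨s, hs, rfl⟩
    exact ⟨(0, s), mem_strip.2 hs, rfl⟩

/-- The area average of the curvature lies between its extrema. -/
theorem integral_scalarCurv_mem_Icc (hρ : 0 < ρ) (hf : ContDiffOn ℝ 2 f (Icc (-ρ) ρ))
    (hfpos : ∀ s ∈ Icc (-ρ) ρ, 0 < f s) (hW : ContDiffOn ℝ 2 W (Icc (-ρ) ρ)) :
    2 * Real.pi * ∫ s in (-ρ)..ρ,
      scalarCurv ρ (conformal f fun q => W q.2) (0, s) * (Real.exp (W s) * f s) ∈
    Icc (Rmin ρ (conformal f fun q => W q.2) * area ρ (conformal f fun q => W q.2))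
      (Rmax ρ (conformal f fun q => W q.2) * area ρ (conformal f fun q => W q.2)) := by
  have hκ := continuousOn_scalarCurv_conformal_comp_snd hρ hf hfpos hW
  have hc := isCompact_Icc.image_of_continuousOn hκ
  rw [← image_scalarCurv_conformal_comp_snd hρ hf hfpos hW] at hc
  have hle : -ρ ≤ ρ := by linarith
  have hm := hW.continuousOn.rexp.mul hf.continuousOn
  have hm' := ContinuousOn.intervalIntegrable_of_Icc (μ := MeasureTheory.volume) hle hm
  have hκm := ContinuousOn.intervalIntegrable_of_Icc (μ := MeasureTheory.volume) hle (hκ.mul hm)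
  have hpi := Real.pi_pos
  have hpos : ∀ s ∈ Icc (-ρ) ρ, 0 ≤ Real.exp (W s) * f s := fun s hs =>
    (mul_pos (Real.exp_pos (W s)) (hfpos s hs)).le
  rw [area_conformal_comp_snd hρ hfpos, mul_left_comm, mul_left_comm (Rmax _ _),
    ← intervalIntegral.integral_const_mul (Rmin _ _), ← intervalIntegral.integral_const_mul (Rmax _ _)]
  refine ⟨mul_le_mul_of_nonneg_left ?_ Real.two_pi_pos.le,
    mul_le_mul_of_nonneg_left ?_ Real.two_pi_pos.le⟩
  · exact intervalIntegral.integral_mono_on hle (hm'.const_mul _) hκm fun s hs =>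
      mul_le_mul_of_nonneg_right (csInf_le hc.bddBelow ⟨(0, s), mem_strip.2 hs, rfl⟩) (hpos s hs)
  · exact intervalIntegral.integral_mono_on hle hκm (hm'.const_mul _) fun s hs =>
      mul_le_mul_of_nonneg_right (le_csSup hc.bddAbove ⟨(0, s), mem_strip.2 hs, rfl⟩) (hpos s hs)

end Profile

/-! ### Behaviour of the curvature under constant scaling -/

section Scaling

variable {ρ : ℝ} {f : ℝ → ℝ} {w : ℝ × ℝ → ℝ}

theorem smul_conformal {c : ℝ} (hc : 0 < c) :
    (fun p => c • conformal f w p) = conformal f fun p => w p + Real.log c := by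
  funext p
  simp only [conformal, Real.exp_add, Real.exp_log hc]
  ext i j
  fin_cases i <;> fin_cases j <;> simp <;> ring

theorem scalarCurv_smul_conformal (hρ : 0 < ρ) (hf : ContDiffOn ℝ 2 f (Icc (-ρ) ρ))
    (hfpos : ∀ s ∈ Icc (-ρ) ρ, 0 < f s) (hw : ContDiffOn ℝ 2 w (strip ρ)) {c : ℝ} (hc : 0 < c)
    {p : ℝ × ℝ} (hp : p ∈ strip ρ) :
    scalarCurv ρ (fun p => c • conformal f w p) p = c⁻¹ * scalarCurv ρ (conformal f w) p := by
  have e1 : ∀ i, ∀ q ∈ strip ρ, pd ρ i (fun p => w p + Real.log c) q = pd ρ i w q :=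
    fun i q hq => by
      rw [pd_add hρ hq i (hw.differentiableOn (by norm_num) q hq)
        (differentiableWithinAt_const _), pd_const, add_zero]
  rw [smul_conformal hc, scalarCurv_conformal hρ hf hfpos hw hp,
    scalarCurv_conformal hρ hf hfpos (hw.add contDiffOn_const) hp, e1 1 p hp,
    pd_congr 0 (e1 0) hp, pd_congr 1 (e1 1) hp, neg_add, Real.exp_add, Real.exp_neg (Real.log c),
    Real.exp_log hc]
  ring

theorem Rmin_Rmax_smul {g g' : Tensor2} {c : ℝ} (hc : 0 ≤ c)
    (h : ∀ p ∈ strip ρ, scalarCurv ρ g' p = c * scalarCurv ρ g p) :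
    Rmin ρ g' = c * Rmin ρ g ∧ Rmax ρ g' = c * Rmax ρ g := by
  have e : scalarCurv ρ g' '' strip ρ = c • (scalarCurv ρ g '' strip ρ) := by
    rw [← image_smul, image_image]
    exact image_congr h
  rw [Rmin, Rmax, e, Real.sInf_smul_of_nonneg hc, Real.sSup_smul_of_nonneg hc]
  exact ⟨rfl, rfl⟩

end Scaling

/-! ### Evolution of the total curvature and the lower bound -/

section CurvatureDecay

variable {ρ : ℝ} {f : ℝ → ℝ} {h : ℝ → Tensor2} {S : EReal} {k₁ k₂ : ℝ}

/-- Extends data continuous on a rectangle to the plane, as the continuity of parametric integrals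
used below needs a globally continuous integrand. -/
theorem continuous_clamp {G : ℝ × ℝ → ℝ} {a b c d : ℝ} (hab : a ≤ b) (hcd : c ≤ d)
    (hG : ContinuousOn G (Icc a b ×ˢ Icc c d)) :
    Continuous fun x : ℝ × ℝ => G (max a (min x.1 b), max c (min x.2 d)) :=
  hG.comp_continuous (by fun_prop) fun _ =>
    ⟨⟨le_max_left _ _, max_le hab (min_le_right _ _)⟩,
      ⟨le_max_left _ _, max_le hcd (min_le_right _ _)⟩⟩

theorem clamp_eq {a b x : ℝ} (hx : x ∈ Icc a b) : max a (min x b) = x := by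
  rw [min_eq_left hx.2, max_eq_right hx.1]

/-- The integral of the scalar curvature of a rotationally symmetric flow with constant geodesic
curvatures `k₁`, `k₂`, expressed by the boundary lengths. -/
noncomputable def totalCurv (ρ : ℝ) (f : ℝ → ℝ) (k₁ k₂ : ℝ) (h : ℝ → Tensor2) (t : ℝ) : ℝ :=
  4 * Real.pi * (-k₁ * (f (-ρ) * Real.exp (logFactor h t (0, -ρ) / 2)) +
    -k₂ * (f ρ * Real.exp (logFactor h t (0, ρ) / 2)))

theorem totalCurv_pos (hρ : 0 < ρ) (hfpos : ∀ s ∈ Icc (-ρ) ρ, 0 < f s) (hk₁ : k₁ ≤ 0)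
    (hk₂ : k₂ ≤ 0) (hneg : k₁ < 0 ∨ k₂ < 0) (t : ℝ) : 0 < totalCurv ρ f k₁ k₂ h t := by
  have h1 : 0 < f (-ρ) := hfpos _ ⟨le_rfl, by linarith⟩
  have h2 : 0 < f ρ := hfpos _ ⟨by linarith, le_rfl⟩
  have e1 := mul_pos h1 (Real.exp_pos (logFactor h t (0, -ρ) / 2))
  have e2 := mul_pos h2 (Real.exp_pos (logFactor h t (0, ρ) / 2))
  have hpi := Real.pi_pos
  refine mul_pos (by positivity) ?_
  rcases hneg with hk | hk
  · exact add_pos_of_pos_of_nonneg (mul_pos (neg_pos.2 hk) e1) (mul_nonneg (neg_nonneg.2 hk₂) e2.le)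
  · exact add_pos_of_nonneg_of_pos (mul_nonneg (neg_nonneg.2 hk₁) e1.le) (mul_pos (neg_pos.2 hk) e2)

namespace IsRicciFlow

theorem contDiffOn_profile (hh : IsRicciFlow ρ (warped f) h S) {t : ℝ} (ht : t ∈ timeInterval S) :
    ContDiffOn ℝ 2 (fun s => logFactor h t (0, s)) (Icc (-ρ) ρ) :=
  (hh.contDiffOn_logFactor ht).comp (f := fun s : ℝ => ((0 : ℝ), s)) (by fun_prop)
    fun _ hs => mem_strip.2 hs

theorem continuousOn_profile (hh : IsRicciFlow ρ (warped f) h S) :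
    ContinuousOn (fun x : ℝ × ℝ => logFactor h x.1 (0, x.2)) (timeInterval S ×ˢ Icc (-ρ) ρ) :=
  hh.continuousOn_logFactor.comp (f := fun x : ℝ × ℝ => (x.1, ((0 : ℝ), x.2))) (by fun_prop)
    fun _ hx => ⟨hx.1, mem_strip.2 hx.2⟩

theorem eqOn_conformal_profile (hh : IsRicciFlow ρ (warped f) h S)
    (hsym : ∀ t ∈ timeInterval S, ∀ s ∈ Icc (-ρ) ρ, ∀ θ,
      logFactor h t (θ, s) = logFactor h t (0, s)) {t : ℝ} (ht : t ∈ timeInterval S) :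
    EqOn (h t) (conformal f fun q => logFactor h t (0, q.2)) (strip ρ) := fun p hp => by
  rw [hh.eqOn_conformal ht hp]
  simp only [conformal, ← hsym t ht p.2 (mem_strip.1 hp) p.1]

/-- The boundary terms in Gauss–Bonnet are the left sides of the Robin conditions. -/
theorem totalCurv_eq_integral (hρ : 0 < ρ) (hf : ContDiffOn ℝ 2 f (Icc (-ρ) ρ))
    (hfpos : ∀ s ∈ Icc (-ρ) ρ, 0 < f s) (hk₁ : ∀ θ, geodCurv ρ (warped f) (-1) θ = k₁)
    (hk₂ : ∀ θ, geodCurv ρ (warped f) 1 θ = k₂) (hh : IsRicciFlow ρ (warped f) h S) {t : ℝ}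
    (ht : t ∈ timeInterval S) :
    totalCurv ρ f k₁ k₂ h t = 2 * Real.pi * ∫ s in (-ρ)..ρ,
      scalarCurv ρ (conformal f fun q => logFactor h t (0, q.2)) (0, s) *
        (Real.exp (logFactor h t (0, s)) * f s) := by
  have hd : ∀ s ∈ Icc (-ρ) ρ, derivWithin (fun s => logFactor h t (0, s)) (Icc (-ρ) ρ) s =
      pd ρ 1 (logFactor h t) (0, s) := fun s hs =>
    (hasDerivWithinAt_line (p := (0, s)) ((hh.contDiffOn_logFactor ht).differentiableOn
      (by norm_num) _ (mem_strip.2 hs))).derivWithin (uniqueDiffOn_Icc (by linarith) s hs)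
  have b1 := hh.boundary_logFactor hρ hf hfpos ht (Or.inr rfl) hk₁ 0
  have b2 := hh.boundary_logFactor hρ hf hfpos ht (Or.inl rfl) hk₂ 0
  simp only [neg_one_mul, one_mul] at b1 b2
  rw [integral_scalarCurv hρ hf hfpos (hh.contDiffOn_profile ht), hd _ ⟨le_rfl, by linarith⟩,
    hd _ ⟨by linarith, le_rfl⟩, b2, neg_eq_iff_eq_neg.1 b1,
    totalCurv]
  ring

theorem totalCurv_mem_Icc (hρ : 0 < ρ) (hf : ContDiffOn ℝ 2 f (Icc (-ρ) ρ))
    (hfpos : ∀ s ∈ Icc (-ρ) ρ, 0 < f s) (hk₁ : ∀ θ, geodCurv ρ (warped f) (-1) θ = k₁)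
    (hk₂ : ∀ θ, geodCurv ρ (warped f) 1 θ = k₂) (hh : IsRicciFlow ρ (warped f) h S)
    (hsym : ∀ t ∈ timeInterval S, ∀ s ∈ Icc (-ρ) ρ, ∀ θ,
      logFactor h t (θ, s) = logFactor h t (0, s)) {t : ℝ} (ht : t ∈ timeInterval S) :
    totalCurv ρ f k₁ k₂ h t ∈
      Icc (Rmin ρ (h t) * area ρ (h t)) (Rmax ρ (h t) * area ρ (h t)) := by
  have e := hh.eqOn_conformal_profile hsym ht
  have eR := scalarCurv_congr e
  rw [hh.totalCurv_eq_integral hρ hf hfpos hk₁ hk₂ ht, area_congr hρ e, Rmin, Rmax,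
    eR.image_eq]
  exact integral_scalarCurv_mem_Icc (W := fun s => logFactor h t (0, s)) hρ hf hfpos
    (hh.contDiffOn_profile ht)

theorem area_pos (hρ : 0 < ρ) (hf : ContDiffOn ℝ 2 f (Icc (-ρ) ρ))
    (hfpos : ∀ s ∈ Icc (-ρ) ρ, 0 < f s) (hh : IsRicciFlow ρ (warped f) h S)
    (hsym : ∀ t ∈ timeInterval S, ∀ s ∈ Icc (-ρ) ρ, ∀ θ,
      logFactor h t (θ, s) = logFactor h t (0, s)) {t : ℝ} (ht : t ∈ timeInterval S) :
    0 < area ρ (h t) := by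
  rw [area_congr hρ (hh.eqOn_conformal_profile hsym ht)]
  exact area_conformal_comp_snd_pos (W := fun s => logFactor h t (0, s)) hρ hf.continuousOn hfpos
    (hh.contDiffOn_profile ht).continuousOn

theorem continuousOn_area (hρ : 0 < ρ) (hf : ContDiffOn ℝ 2 f (Icc (-ρ) ρ))
    (hfpos : ∀ s ∈ Icc (-ρ) ρ, 0 < f s) (hh : IsRicciFlow ρ (warped f) h S)
    (hsym : ∀ t ∈ timeInterval S, ∀ s ∈ Icc (-ρ) ρ, ∀ θ,
      logFactor h t (θ, s) = logFactor h t (0, s)) {t : ℝ} (ht : t ∈ timeInterval S) :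
    ContinuousOn (fun τ => area ρ (h τ)) (Icc 0 t) := by
  have hle : -ρ ≤ ρ := by linarith
  have hc : ContinuousOn (fun x : ℝ × ℝ => Real.exp (logFactor h x.1 (0, x.2)) * f x.2)
      (Icc 0 t ×ˢ Icc (-ρ) ρ) :=
    (hh.continuousOn_profile.mono (prod_mono (Icc_subset_timeInterval ht) le_rfl)).rexp.mul
      (hf.continuousOn.comp continuousOn_snd fun _ hx => hx.2)
  have := (intervalIntegral.continuous_parametric_intervalIntegral_of_continuous' (μ :=
    MeasureTheory.volume) (f := fun τ s => (fun x : ℝ × ℝ =>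
      Real.exp (logFactor h x.1 (0, x.2)) * f x.2) (max 0 (min τ t), max (-ρ) (min s ρ)))
    (continuous_clamp ht.1 hle hc) (-ρ) ρ).const_mul (2 * Real.pi)
  refine this.continuousOn.congr fun τ hτ => ?_
  simp only
  rw [area_congr hρ (hh.eqOn_conformal_profile hsym (Icc_subset_timeInterval ht hτ)),
    area_conformal_comp_snd (W := fun s => logFactor h τ (0, s)) hρ hfpos]
  congr 1
  refine intervalIntegral.integral_congr fun s hs => ?_
  rw [uIcc_of_le hle] at hs
  simp only [clamp_eq hτ, clamp_eq hs]

theorem normTime_deriv (hρ : 0 < ρ) (hf : ContDiffOn ℝ 2 f (Icc (-ρ) ρ))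
    (hfpos : ∀ s ∈ Icc (-ρ) ρ, 0 < f s) (hh : IsRicciFlow ρ (warped f) h S)
    (hsym : ∀ t ∈ timeInterval S, ∀ s ∈ Icc (-ρ) ρ, ∀ θ,
      logFactor h t (θ, s) = logFactor h t (0, s)) {t : ℝ} (ht : t ∈ timeInterval S) :
    ContinuousOn (normTime ρ h) (Icc 0 t) ∧
      ∀ τ ∈ Ioo 0 t, HasDerivAt (normTime ρ h) (area ρ (h τ))⁻¹ τ := by
  have hc : ContinuousOn (fun τ => (area ρ (h τ))⁻¹) (Icc 0 t) :=
    (hh.continuousOn_area hρ hf hfpos hsym ht).inv₀ fun τ hτ =>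
      (hh.area_pos hρ hf hfpos hsym (Icc_subset_timeInterval ht hτ)).ne'
  have hc' : Continuous fun τ => (area ρ (h (max 0 (min τ t))))⁻¹ :=
    hc.comp_continuous (f := fun τ => max 0 (min τ t)) (by fun_prop) fun τ =>
      ⟨le_max_left _ _, max_le ht.1 (min_le_right _ _)⟩
  have hd : ∀ τ, HasDerivAt (fun τ => ∫ x in (0 : ℝ)..τ, (area ρ (h (max 0 (min x t))))⁻¹)
      (area ρ (h (max 0 (min τ t))))⁻¹ τ := fun τ =>
    (hc'.integral_hasStrictDerivAt 0 τ).hasDerivAt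
  have e : EqOn (normTime ρ h) (fun τ => ∫ x in (0 : ℝ)..τ, (area ρ (h (max 0 (min x t))))⁻¹)
      (Icc 0 t) := fun τ hτ => by
    refine intervalIntegral.integral_congr fun x hx => ?_
    rw [uIcc_of_le hτ.1] at hx
    simp only [clamp_eq (⟨hx.1, hx.2.trans hτ.2⟩ : x ∈ Icc 0 t)]
  refine ⟨ContinuousOn.congr (fun τ _ => (hd τ).continuousAt.continuousWithinAt) e,
    fun τ hτ => ?_⟩
  have := hd τ
  rw [clamp_eq (Ioo_subset_Icc_self hτ)] at this
  exact this.congr_of_eventuallyEq (e.eventuallyEq_of_mem (Icc_mem_nhds hτ.1 hτ.2))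

theorem continuousOn_totalCurv (hρ : 0 < ρ) (hh : IsRicciFlow ρ (warped f) h S) {t : ℝ}
    (ht : t ∈ timeInterval S) : ContinuousOn (totalCurv ρ f k₁ k₂ h) (Icc 0 t) := by
  have hc : ∀ s ∈ Icc (-ρ) ρ, ContinuousOn (fun τ => logFactor h τ (0, s)) (Icc 0 t) :=
    fun s hs => hh.continuousOn_profile.comp (f := fun τ : ℝ => (τ, s)) (by fun_prop)
      fun τ hτ => ⟨Icc_subset_timeInterval ht hτ, hs⟩
  have c1 := hc (-ρ) ⟨le_rfl, by linarith⟩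
  have c2 := hc ρ ⟨by linarith, le_rfl⟩
  unfold totalCurv
  fun_prop

/-- Each length element `e ^ (w / 2) f` decays at rate `R / 2`. A common boundary value of `R`
closes this into a single equation for the weighted sum. -/
theorem hasDerivAt_totalCurv (hρ : 0 < ρ) (hh : IsRicciFlow ρ (warped f) h S) {t r : ℝ}
    (ht : t ∈ timeInterval S) (h0 : 0 < t) (hr₁ : scalarCurv ρ (h t) (0, -ρ) = r)
    (hr₂ : scalarCurv ρ (h t) (0, ρ) = r) :
    HasDerivAt (totalCurv ρ f k₁ k₂ h) (-(r / 2) * totalCurv ρ f k₁ k₂ h t) t := by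
  have d1 := hh.hasDerivAt_logFactor ht h0 (p := (0, -ρ)) (mem_strip.2 ⟨le_rfl, by linarith⟩)
  have d2 := hh.hasDerivAt_logFactor ht h0 (p := (0, ρ)) (mem_strip.2 ⟨by linarith, le_rfl⟩)
  rw [hr₁] at d1
  rw [hr₂] at d2
  refine ((((d1.div_const 2).exp.const_mul _).const_mul _).add
    (((d2.div_const 2).exp.const_mul _).const_mul _) |>.const_mul _).congr_deriv ?_
  rw [totalCurv]
  ring

/-- The lower bound for the total curvature at the rescaled time. -/
theorem two_div_le_totalCurv (hρ : 0 < ρ) (hf : ContDiffOn ℝ 2 f (Icc (-ρ) ρ))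
    (hfpos : ∀ s ∈ Icc (-ρ) ρ, 0 < f s) (hk₁ : ∀ θ, geodCurv ρ (warped f) (-1) θ = k₁)
    (hk₂ : ∀ θ, geodCurv ρ (warped f) 1 θ = k₂) (hk₁_nonpos : k₁ ≤ 0) (hk₂_nonpos : k₂ ≤ 0)
    (hneg : k₁ < 0 ∨ k₂ < 0) (hh : IsRicciFlow ρ (warped f) h S)
    (hsym : ∀ t ∈ timeInterval S, ∀ s ∈ Icc (-ρ) ρ, ∀ θ,
      logFactor h t (θ, s) = logFactor h t (0, s))
    (hmin : ∀ t ∈ timeInterval S, scalarCurv ρ (h t) (0, -ρ) = Rmin ρ (h t) ∧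
      scalarCurv ρ (h t) (0, ρ) = Rmin ρ (h t)) {t : ℝ} (ht : t ∈ timeInterval S) :
    2 / (normTime ρ h t + 2 / totalCurv ρ f k₁ k₂ h 0) ≤ totalCurv ρ f k₁ k₂ h t := by
  have hP := totalCurv_pos (h := h) hρ hfpos hk₁_nonpos hk₂_nonpos hneg
  obtain ⟨hnc, hnd⟩ := hh.normTime_deriv hρ hf hfpos hsym ht
  -- The derivative is `Rmin / (2 P) - 1 / (2 A)`, nonpositive because `Rmin * A ≤ P`.
  have hd : ∀ τ ∈ Ioo 0 t,
      HasDerivAt (fun τ => (totalCurv ρ f k₁ k₂ h τ)⁻¹ - normTime ρ h τ / 2)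
        (Rmin ρ (h τ) / 2 / totalCurv ρ f k₁ k₂ h τ - (area ρ (h τ))⁻¹ / 2) τ := fun τ hτ => by
    have hτ' := Icc_subset_timeInterval ht (Ioo_subset_Icc_self hτ)
    have h1 := hh.hasDerivAt_totalCurv (k₁ := k₁) (k₂ := k₂) hρ hτ' hτ.1 (hmin τ hτ').1
      (hmin τ hτ').2
    refine ((h1.inv (hP τ).ne').sub ((hnd τ hτ).div_const 2)).congr_deriv ?_
    have := hP τ
    field_simp
  have hanti : AntitoneOn (fun τ => (totalCurv ρ f k₁ k₂ h τ)⁻¹ - normTime ρ h τ / 2)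
      (Icc 0 t) := by
    refine antitoneOn_of_deriv_nonpos (convex_Icc _ _)
      (((hh.continuousOn_totalCurv hρ ht).inv₀ fun τ _ => (hP τ).ne').sub (hnc.div_const 2)) ?_ ?_
    · rw [interior_Icc]
      exact fun τ hτ => (hd τ hτ).differentiableAt.differentiableWithinAt
    · rw [interior_Icc]
      intro τ hτ
      have hτ' := Icc_subset_timeInterval ht (Ioo_subset_Icc_self hτ)
      have hA := hh.area_pos hρ hf hfpos hsym hτ'
      have hm := (hh.totalCurv_mem_Icc hρ hf hfpos hk₁ hk₂ hsym hτ').1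
      have hPτ := hP τ
      rw [(hd τ hτ).deriv, sub_nonpos, div_right_comm]
      refine div_le_div_of_nonneg_right ?_ zero_le_two
      rw [div_le_iff₀ hPτ, ← div_eq_inv_mul, le_div_iff₀ hA]
      exact hm
  have h1 := hanti ⟨le_rfl, ht.1⟩ ⟨ht.1, le_rfl⟩ ht.1
  simp only [normTime, intervalIntegral.integral_same, zero_div, sub_zero] at h1
  have h2 : 2 * (totalCurv ρ f k₁ k₂ h t)⁻¹ ≤ normTime ρ h t + 2 / totalCurv ρ f k₁ k₂ h 0 := by
    rw [normTime, div_eq_mul_inv]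
    linarith
  have h3 := hP t
  have h4 : 0 < normTime ρ h t + 2 / totalCurv ρ f k₁ k₂ h 0 := lt_of_lt_of_le (by positivity) h2
  rw [div_le_iff₀ h4]
  calc 2 = totalCurv ρ f k₁ k₂ h t * (2 * (totalCurv ρ f k₁ k₂ h t)⁻¹) := by field_simp
    _ ≤ _ := mul_le_mul_of_nonneg_left h2 h3.le

end IsRicciFlow

/-- Otherwise `(t + c) C e ^ (-δ t)` would stay at least `2`, although it tends to zero. -/
theorem not_eventually_le_exp {F : ℝ → ℝ} {c : ℝ} (hc : 0 < c)
    (hF : ∀ t, 0 ≤ t → 2 / (t + c) ≤ F t) (C : ℝ) {δ : ℝ} (hδ : 0 < δ) :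
    ¬ ∀ᶠ t in atTop, F t ≤ C * Real.exp (-(δ * t)) := by
  intro hev
  have l1 : Tendsto (fun t : ℝ => (t + c) * (C * Real.exp (-(δ * t)))) atTop (𝓝 0) := by
    have e0 := tendsto_rpow_mul_exp_neg_mul_atTop_nhds_zero 0 δ hδ
    have e1 := tendsto_rpow_mul_exp_neg_mul_atTop_nhds_zero 1 δ hδ
    have := (e1.const_mul C).add (e0.const_mul (c * C))
    simp only [Real.rpow_one, Real.rpow_zero, mul_zero, add_zero, one_mul] at this
    refine this.congr fun t => ?_
    rw [neg_mul]
    ring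
  obtain ⟨t, h1, h2, h3⟩ := ((l1.eventually (gt_mem_nhds two_pos)).and
    (hev.and (eventually_ge_atTop 0))).exists
  have h4 := (hF t h3).trans h2
  rw [div_le_iff₀ (by linarith)] at h4
  linarith

end CurvatureDecay

end RicciCylinder

/-! ### The main theorem -/

open RicciCylinder in
theorem mainTheorem6 (ρ : ℝ) (hρ : 0 < ρ) (f : ℝ → ℝ)
    (hf : ContDiffOn ℝ 2 f (Set.Icc (-ρ) ρ)) (hfpos : ∀ s ∈ Set.Icc (-ρ) ρ, 0 < f s)
    (k₁ k₂ : ℝ)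
    (hk₁ : ∀ θ, geodCurv ρ (warped f) (-1) θ = k₁) (hk₂ : ∀ θ, geodCurv ρ (warped f) 1 θ = k₂)
    (hk₁_nonpos : k₁ ≤ 0) (hk₂_nonpos : k₂ ≤ 0) (hneg : k₁ < 0 ∨ k₂ < 0) :
    ∃ c₂ : ℝ, 0 < c₂ ∧
      ∀ (g : ℝ → Tensor2) (T : EReal), IsNormalisedRicciFlow ρ (warped f) g T →
        (∀ t ∈ timeInterval T,
          (∃ θ, scalarCurv ρ (g t) (θ, -ρ) = Rmin ρ (g t)) ∧
          (∃ θ, scalarCurv ρ (g t) (θ, ρ) = Rmin ρ (g t))) →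
        (∀ t ∈ timeInterval T, 2 / (t + c₂) ≤ Rmax ρ (g t)) ∧
        (T = ⊤ → ∀ C δ : ℝ, 0 < δ →
          ¬ ∀ᶠ t in Filter.atTop, Rmax ρ (g t) ≤ C * Real.exp (-(δ * t))) := by
  have hP₀ := totalCurv_pos (h := fun _ => warped f) hρ hfpos hk₁_nonpos hk₂_nonpos hneg 0
  -- The constant family stands in for the flow, so that the constant is chosen before the flow;
  -- only its value at time `0` enters.
  refine ⟨2 / totalCurv ρ f k₁ k₂ (fun _ => warped f) 0, by positivity, fun g T hg hmin => ?_⟩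
  obtain ⟨h, S, hh, himage, hgh⟩ := hg
  have hl : -ρ ∈ Set.Icc (-ρ) ρ := ⟨le_rfl, by linarith⟩
  have hr : ρ ∈ Set.Icc (-ρ) ρ := ⟨by linarith, le_rfl⟩
  have hsym : ∀ t ∈ timeInterval S, ∀ s ∈ Set.Icc (-ρ) ρ, ∀ θ,
      logFactor h t (θ, s) = logFactor h t (0, s) := fun t ht s hs θ =>
    hh.logFactor_rotate hρ hf hfpos hk₁ hk₂ hk₁_nonpos hk₂_nonpos ht hs θ
  have hscale : ∀ τ ∈ timeInterval S, ∀ p ∈ strip ρ, scalarCurv ρ (g (normTime ρ h τ)) p =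
      area ρ (h τ) * scalarCurv ρ (h τ) p := fun τ hτ p hp => by
    have hA := hh.area_pos hρ hf hfpos hsym hτ
    have e : Set.EqOn (g (normTime ρ h τ))
        (fun p => (area ρ (h τ))⁻¹ • conformal f (logFactor h τ) p) (strip ρ) := fun q hq => by
      rw [hgh τ hτ q hq, hh.eqOn_conformal hτ hq]
    rw [scalarCurv_congr e hp, scalarCurv_smul_conformal hρ hf hfpos
      (hh.contDiffOn_logFactor hτ) (inv_pos.2 hA) hp, inv_inv,
      scalarCurv_congr (hh.eqOn_conformal hτ) hp]
  -- The minimum is assumed at some angle on each component; symmetry moves it to `θ = 0`, and the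
  -- area factor cancels.
  have hmin' : ∀ τ ∈ timeInterval S, scalarCurv ρ (h τ) (0, -ρ) = Rmin ρ (h τ) ∧
      scalarCurv ρ (h τ) (0, ρ) = Rmin ρ (h τ) := fun τ hτ => by
    have hA := hh.area_pos hρ hf hfpos hsym hτ
    have hθ : ∀ s ∈ Set.Icc (-ρ) ρ, ∀ θ, scalarCurv ρ (h τ) (θ, s) = scalarCurv ρ (h τ) (0, s) :=
      fun s hs θ => by
        have e := scalarCurv_congr (hh.eqOn_conformal_profile hsym hτ)
        rw [e (mem_strip.2 hs), e (mem_strip.2 hs), scalarCurv_conformal_comp_snd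
          (W := fun s => logFactor h τ (0, s)) hρ hf hfpos (hh.contDiffOn_profile hτ) (p := (θ, s))
          (mem_strip.2 hs), scalarCurv_conformal_comp_snd (W := fun s => logFactor h τ (0, s)) hρ hf
          hfpos (hh.contDiffOn_profile hτ) (p := (0, s)) (mem_strip.2 hs)]
    have hR := (Rmin_Rmax_smul hA.le (hscale τ hτ)).1
    obtain ⟨⟨θ₁, e₁⟩, ⟨θ₂, e₂⟩⟩ := hmin _ (himage ▸ Set.mem_image_of_mem _ hτ)
    rw [hR, hscale τ hτ _ (mem_strip.2 hl), hθ _ hl] at e₁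
    rw [hR, hscale τ hτ _ (mem_strip.2 hr), hθ _ hr] at e₂
    exact ⟨mul_left_cancel₀ hA.ne' e₁, mul_left_cancel₀ hA.ne' e₂⟩
  have main : ∀ t ∈ timeInterval T,
      2 / (t + 2 / totalCurv ρ f k₁ k₂ (fun _ => warped f) 0) ≤ Rmax ρ (g t) := fun t ht => by
    obtain ⟨τ, hτ, rfl⟩ := himage.symm ▸ ht
    have hA := hh.area_pos hρ hf hfpos hsym hτ
    have h0 : (0 : ℝ) ∈ timeInterval S := timeInterval_mono hτ le_rfl hτ.1
    have e : totalCurv ρ f k₁ k₂ (fun _ => warped f) 0 = totalCurv ρ f k₁ k₂ h 0 := by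
      simp only [totalCurv, hh.logFactor_zero (mem_strip.2 hl : ((0 : ℝ), -ρ) ∈ strip ρ),
        hh.logFactor_zero (mem_strip.2 hr : ((0 : ℝ), ρ) ∈ strip ρ)]
      simp [logFactor, warped]
    rw [e, (Rmin_Rmax_smul hA.le (hscale τ hτ)).2, mul_comm (area _ _)]
    exact (hh.two_div_le_totalCurv hρ hf hfpos hk₁ hk₂ hk₁_nonpos hk₂_nonpos hneg hsym hmin'
      hτ).trans (hh.totalCurv_mem_Icc hρ hf hfpos hk₁ hk₂ hsym hτ).2
  refine ⟨main, ?_⟩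
  rintro rfl C δ hδ
  exact not_eventually_le_exp (by positivity) (fun t ht => main t ⟨ht, EReal.coe_lt_top t⟩) C hδ
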